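/- A signature $\sigma$ is a finite set of relation symbols $R$, each with an arity $\operatorname{arity}(R)\ge 1$; a $\sigma$-structure $\mathbf A$ consists of a finite set $A$ and a relation $R(\mathbf A)\subseteq A^{\operatorname{arity}(R)}$ for each $R\in\sigma$. Let $\mathcal C_{\mathbf A}$ be the set of constraints $R(\mathbf a)$, i.e. of pairs $(\mathbf a,R)$ with $R\in\sigma$, $\mathbf a\in R(\mathbf A)$, and let $\mathrm{Hom}(\mathbf Q;\mathbf A)$ be the number of homomorphisms $\mathbf Q\to\mathbf A$. A tree-decomposition of $\mathbf Q$ is a finite tree $G=(V,E)$ with a map $\beta:V\to\mathcal P(Q)$ such that for every constraint of $\mathbf Q$ some $\beta(v)$ contains all its entries, and such that $q\in\beta(u)\cap\beta(v)$ implies $q\in\beta(w)$ for every node $w$ on the path from $u$ to $v$ in $G$. Its width is $\max_v|\beta(v)|-1$; the treewidth of $\mathbf Q$ is the smallest width of a tree-decomposition of $\mathbf Q$. For a label $\ell=(S,R)$, where $R\in\sigma$ and $S\subseteq[\operatorname{arity}(R)]$, let $M^\ell_{\mathbf A}$ be the $A\times\mathcal C_{\mathbf A}$ matrix whose entry at $(a,R'(\mathbf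 a))$ is $1$ if $R'=R$ and $S=\{i: \mathbf a[i]=a\}$, and $0$ otherwise. Structures $\mathbf A,\mathbf B$ over the same signature are fractionally isomorphic if there are doubly stochastic real matrices $X$ (indexed by $B\times A$) and $Y$ (indexed by $\mathcal C_{\mathbf B}\times\mathcal C_{\mathbf A}$) with $XM^\ell_{\mathbf A}=M^\ell_{\mathbf B}Y$ and $M^\ell_{\mathbf A}Y^T=X^TM^\ell_{\mathbf B}$ for all labels $\ell$. For $k\ge1$, $\mathbf A^{*k}$ is the structure with universe the disjoint union of $A^1,\dots,A^k$ and $\mathcal C_{\mathbf A}$, and with the following relations, where $j,j'$ range over $\{1,\dots,k\}$ and $R$ over $\sigma$, and where $\pi_{\mathbf i}\mathbf a=(\mathbf a[i_1],\mathbf a[i_2],\dots)$: * the unary relations $T_{j,S}=\{\mathbf a\in A^j: a_i=a_{i'}\ \forall i,i'\in S\}$ for $S\subseteq[j]$; * the binary relations $T_{j,\mathbf i}=\{(\mathbf a,\pi_{\mathbf i}\mathbf a):\mathbf a\in A^j\}$ for $\mathbf i\in[j]^{j'}$; * the unary relations $R_S=\{R(\mathbf a)\in\mathcal C_{\mathbf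 A}: a_i=a_{i'}\ \forall i,i'\in S\}$ for $S\subseteq[\operatorname{arity}(R)]$; * the binary relations $R_{\mathbf i}=\{(R(\mathbf a),\pi_{\mathbf i}\mathbf a):\mathbf a\in R(\mathbf A)\}$ for $\mathbf i\in[\operatorname{arity}(R)]^{j}$. Write $\mathbf A\equiv_k\mathbf B$ if $\mathbf A^{*k}$ and $\mathbf B^{*k}$ are fractionally isomorphic. **Lemma.** Let $k\ge1$ and suppose that every relation symbol in $\sigma$ has arity at most $k$. Then for all $\sigma$-structures $\mathbf A,\mathbf B$ the following are equivalent: 1. $\mathbf A\equiv_k\mathbf B$; 2. $\mathrm{Hom}(\mathbf Q;\mathbf A)=\mathrm{Hom}(\mathbf Q;\mathbf B)$ for every $\sigma$-structure $\mathbf Q$ of treewidth less than $k$. -/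

import Mathlib

universe u v a b q

/-!
Finite relational signatures are relational first-order languages `L` with finitely many relation
symbols; `σ`-structures are Mathlib's `L.Structure`, homomorphisms are Mathlib's `Q →[L] A`.
-/
namespace RelWL

open FirstOrder FirstOrder.Language

/-- The relation symbols of the signature; the arity of `R : Sym L` is `R.1`. -/
abbrev Sym (L : FirstOrder.Language.{u, v}) : Type v := Σ n, L.Relations n

/-- `Hom(Q; A)`: the number of homomorphisms from `Q` to `A`. -/
noncomputable def homCount (L : FirstOrder.Language.{u, v}) (Q : Type q) (A : Type a)
    [L.Structure Q] [L.Structure A] : ℕ :=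
  Nat.card (Q →[L] A)

/-- The set `𝒞_A` of constraints `R(a)` of `A`: pairs of a relation symbol `R` and a tuple
`a ∈ R(A)`. -/
structure Constraint (L : FirstOrder.Language.{u, v}) (A : Type a) [L.Structure A] where
  sym : Sym L
  tup : Fin sym.1 → A
  holds : Structure.RelMap sym.2 tup

instance (L : FirstOrder.Language.{u, v}) (A : Type a) [L.Structure A] [Finite (Sym L)] [Finite A] :
    Finite (Constraint L A) := by
  refine Finite.of_injective
    (β := Σ R : Sym L, (Fin R.1 → A)) (fun c => ⟨c.sym, c.tup⟩) ?_
  rintro ⟨s, t, h⟩ ⟨s', t', h'⟩ e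
  simp only [Sigma.mk.injEq] at e
  obtain ⟨rfl, e⟩ := e
  cases eq_of_heq e
  rfl

noncomputable instance (L : FirstOrder.Language.{u, v}) (A : Type a) [L.Structure A] [Finite (Sym L)]
    [Finite A] : Fintype (Constraint L A) :=
  Fintype.ofFinite _

/-! ### Tree-decompositions -/

/-- A tree-decomposition of the structure `A`: a finite tree (on the vertex set `Fin n`) whose
nodes carry bags of elements of `A`. Every constraint lies in a bag, and the nodes whose bag
contains a given element are closed under taking paths. (Elements which occur in no constraint need
not lie in a bag; they could always be put into new one-element bags.) -/
structure TreeDecomposition (L : FirstOrder.Language.{u, v}) (A : Type a) [L.Structure A] where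
  n : ℕ
  G : SimpleGraph (Fin n)
  isTree : G.IsTree
  bag : Fin n → Finset A
  constraint_subset : ∀ c : Constraint L A, ∃ w, ∀ i, c.tup i ∈ bag w
  mem_of_path : ∀ (x : A) (w₁ w₂ : Fin n) (p : G.Walk w₁ w₂), p.IsPath →
    x ∈ bag w₁ → x ∈ bag w₂ → ∀ w ∈ p.support, x ∈ bag w

/-- The width: the maximal size of a bag, minus one. -/
def TreeDecomposition.width {L : FirstOrder.Language.{u, v}} {A : Type a} [L.Structure A]
    (D : TreeDecomposition L A) : ℤ :=
  ((Finset.univ.sup fun w => (D.bag w).card : ℕ) : ℤ) - 1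

/-- The treewidth: the smallest width of a tree-decomposition. For a finite structure the set of
widths is nonempty and bounded below by `-1`, so that this infimum is a minimum. -/
noncomputable def treewidth (L : FirstOrder.Language.{u, v}) (A : Type a) [L.Structure A] : ℤ :=
  sInf (Set.range fun D : TreeDecomposition L A => D.width)

/-! ### Fractional isomorphism -/

/-- Labels: pairs of a relation symbol `R` and a subset `S` of `[arity R]`. -/
abbrev Label (L : FirstOrder.Language.{u, v}) : Type v := Σ R : Sym L, Finset (Fin R.1)

open Classical in
/-- The entry `M_A[x, R(a)] = (S, R)` of the matrix representation, where `S` is the set of the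
positions at which `x` occurs in the tuple `a`. -/
noncomputable def label {L : FirstOrder.Language.{u, v}} {A : Type a} [L.Structure A] (x : A)
    (c : Constraint L A) : Label L :=
  ⟨c.sym, Finset.univ.filter fun i => c.tup i = x⟩

open Classical in
/-- The 0-1 matrix `M_A^ℓ`. -/
noncomputable def incidence {L : FirstOrder.Language.{u, v}} (A : Type a) [L.Structure A] (l : Label L) :
    Matrix A (Constraint L A) ℝ :=
  fun x c => if label x c = l then 1 else 0

/-- Doubly stochastic matrices, with rows and columns indexed by arbitrary finite sets. That the
matrix is square follows, see `IsDoublyStochastic.card_eq`. -/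
def IsDoublyStochastic {m : Type*} {n : Type*} [Fintype m] [Fintype n] (X : Matrix m n ℝ) : Prop :=
  (∀ i j, 0 ≤ X i j) ∧ (∀ i, ∑ j, X i j = 1) ∧ ∀ j, ∑ i, X i j = 1

theorem IsDoublyStochastic.card_eq {m : Type*} {n : Type*} [Fintype m] [Fintype n]
    {X : Matrix m n ℝ} (h : IsDoublyStochastic X) : Fintype.card m = Fintype.card n := by
  have e : ∑ i, ∑ j, X i j = ∑ j, ∑ i, X i j := Finset.sum_comm
  simp only [h.2.1, h.2.2] at e
  simpa using e

open scoped Matrix in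
/-- Fractional isomorphism of finite relational structures. -/
def FracIso (L : FirstOrder.Language.{u, v}) [L.IsRelational] [Finite (Sym L)] (A : Type a) (B : Type b)
    [L.Structure A] [L.Structure B] [Fintype A] [Fintype B] : Prop :=
  ∃ (X : Matrix B A ℝ) (Y : Matrix (Constraint L B) (Constraint L A) ℝ),
    IsDoublyStochastic X ∧ IsDoublyStochastic Y ∧
    ∀ l : Label L,
      X * incidence A l = incidence B l * Y ∧ incidence A l * Yᵀ = Xᵀ * incidence B l

/-! ### The structure `A^{*k}` -/

/-- The universe of `A^{*k}`: the disjoint union of the sets `A^j`, `1 ≤ j ≤ k`, and of `𝒞_A`. -/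
inductive Star (L : FirstOrder.Language.{u, v}) (k : ℕ) (A : Type a) [L.Structure A] : Type (max v a)
  | tuple (j : Set.Icc 1 k) (x : Fin j → A) : Star L k A
  | constr (c : Constraint L A) : Star L k A

instance (L : FirstOrder.Language.{u, v}) (k : ℕ) (A : Type a) [L.Structure A] [Finite (Sym L)] [Finite A] :
    Finite (Star L k A) := by
  refine Finite.of_surjective
    (α := (Σ j : Set.Icc 1 k, (Fin j → A)) ⊕ Constraint L A)
    (Sum.elim (fun p => .tuple p.1 p.2) .constr) ?_
  rintro (⟨j, x⟩ | c)
  · exact ⟨.inl ⟨j, x⟩, rfl⟩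
  · exact ⟨.inr c, rfl⟩

noncomputable instance (L : FirstOrder.Language.{u, v}) (k : ℕ) (A : Type a) [L.Structure A]
    [Finite (Sym L)] [Finite A] : Fintype (Star L k A) :=
  Fintype.ofFinite _

/-- The relation symbols of the signature of `A^{*k}`, sorted by arity: the unary symbols
`T_{j,S}` and `R_S` and the binary symbols `T_{j,i}` and `R_i`. -/
inductive StarRel (L : FirstOrder.Language.{u, v}) (k : ℕ) : ℕ → Type v
  | tupleEq (j : Set.Icc 1 k) (S : Finset (Fin j)) : StarRel L k 1
  | tupleProj (j j' : Set.Icc 1 k) (i : Fin j' → Fin j) : StarRel L k 2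
  | relEq (R : Sym L) (S : Finset (Fin R.1)) : StarRel L k 1
  | relProj (R : Sym L) (j : Set.Icc 1 k) (i : Fin j → Fin R.1) : StarRel L k 2

/-- The signature of `A^{*k}`. -/
def starLanguage (L : FirstOrder.Language.{u, v}) (k : ℕ) : FirstOrder.Language.{0, v} :=
  ⟨fun _ => Empty, StarRel L k⟩

instance (L : FirstOrder.Language.{u, v}) (k : ℕ) : (starLanguage L k).IsRelational :=
  fun _ => inferInstanceAs (IsEmpty Empty)

instance (L : FirstOrder.Language.{u, v}) (k : ℕ) [Finite (Sym L)] : Finite (Sym (starLanguage L k)) := by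
  refine Finite.of_surjective
    (α := (Σ j : Set.Icc 1 k, Finset (Fin j)) ⊕
      (Σ j : Set.Icc 1 k, Σ j' : Set.Icc 1 k, (Fin j' → Fin j)) ⊕
      (Σ R : Sym L, Finset (Fin R.1)) ⊕
      (Σ R : Sym L, Σ j : Set.Icc 1 k, (Fin j → Fin R.1)))
    (Sum.elim (fun p => ⟨1, StarRel.tupleEq p.1 p.2⟩)
      (Sum.elim (fun p => ⟨2, StarRel.tupleProj p.1 p.2.1 p.2.2⟩)
        (Sum.elim (fun p => ⟨1, StarRel.relEq p.1 p.2⟩)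
          (fun p => ⟨2, StarRel.relProj p.1 p.2.1 p.2.2⟩)))) ?_
  rintro ⟨_, R⟩
  cases R with
  | tupleEq j S => exact ⟨.inl ⟨j, S⟩, rfl⟩
  | tupleProj j j' i => exact ⟨.inr (.inl ⟨j, j', i⟩), rfl⟩
  | relEq R S => exact ⟨.inr (.inr (.inl ⟨R, S⟩)), rfl⟩
  | relProj R j i => exact ⟨.inr (.inr (.inr ⟨R, j, i⟩)), rfl⟩

/-- The relations of `A^{*k}`. -/
def starRelMap {L : FirstOrder.Language.{u, v}} {k : ℕ} {A : Type a} [L.Structure A] :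
    ∀ {n : ℕ}, StarRel L k n → (Fin n → Star L k A) → Prop
  | _, .tupleEq j S, y =>
      ∃ x : Fin j → A, y 0 = .tuple j x ∧ ∀ i ∈ S, ∀ i' ∈ S, x i = x i'
  | _, .tupleProj j j' i, y =>
      ∃ x : Fin j → A, y 0 = .tuple j x ∧ y 1 = .tuple j' (fun s => x (i s))
  | _, .relEq R S, y =>
      ∃ (x : Fin R.1 → A) (h : Structure.RelMap R.2 x),
        y 0 = .constr ⟨R, x, h⟩ ∧ ∀ i ∈ S, ∀ i' ∈ S, x i = x i'
  | _, .relProj R j i, y =>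
      ∃ (x : Fin R.1 → A) (h : Structure.RelMap R.2 x),
        y 0 = .constr ⟨R, x, h⟩ ∧ y 1 = .tuple j (fun s => x (i s))

/-- The structure `A^{*k}`. -/
instance (L : FirstOrder.Language.{u, v}) (k : ℕ) (A : Type a) [L.Structure A] :
    (starLanguage L k).Structure (Star L k A) where
  funMap f := f.elim
  RelMap R y := starRelMap R y

/-- `A ≡_k B`: the structures `A^{*k}` and `B^{*k}` are fractionally isomorphic. -/
def EqWL (L : FirstOrder.Language.{u, v}) [Finite (Sym L)] (k : ℕ) (A : Type a) (B : Type b)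
    [L.Structure A] [L.Structure B] [Fintype A] [Fintype B] : Prop :=
  FracIso (starLanguage L k) (Star L k A) (Star L k B)

end RelWL

/-! Both conditions are equivalent to the existence of a coupling (`IsCoupling`), a linear
relaxation of a winning strategy in the bijective k-pebble game.

Coupling and fractional isomorphism. An element of `A^{*k}` is a sort together with a tuple, which
can be padded to length k. A constraint of `A^{*k}` is determined by its symbol and its first entry,
the other entries being projections of it. So the intertwining equations amount to compatibility
with projections, and the symbols T_{j,S} and R_i force the support to respect equalities and
relations. The block of the matrix on k-tuples is a coupling (`EqWL.exists_isCoupling`); conversely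
a coupling fills both matrices via padding (`IsCoupling.eqWL`).

From a coupling to counts. A homomorphism count is a sum over all maps of a product of 0-1 weights
attached to the bags. Elements are summed out and leaves absorbed until one empty bag is left. As
bags have at most k elements, the coupling preserves the agreement of the weights over `A` and `B`
when an element is summed out (`IsCoupling.sum_update_eq`).

From counts to a coupling. Formal terms describe functions of a k-tuple that count extensions to
structures of small treewidth; the sum of a term over all tuples is a homomorphism count
(`sum_eval_eq`). The real span of these functions on the disjoint union of the k-tuples of `A` and
of `B` is an algebra, so it contains the indicator of each class of tuples on which all terms agree
(`indicator_mem`), and it is closed under summation over fibres of reindexing maps (`exists_push`).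
Hence a class has equally many members in `A` and in `B`, fibre sizes depend only on classes, and
the uniform distribution on each class gives a coupling. -/

namespace RelWL

open FirstOrder FirstOrder.Language

/-! ### Counting terms on k-tuples -/

/-- Terms denoting the numbers of homomorphisms, extending a given `k`-tuple, from structures of
treewidth less than `k`. -/
inductive Term (L : FirstOrder.Language.{u, v}) (k : ℕ) : Type v
  | one : Term L k
  | rel (R : Sym L) (s : Fin R.1 → Fin k) : Term L k
  | eq (s t : Fin k) : Term L k
  | mul (t₁ t₂ : Term L k) : Term L k
  | subst (i : Fin k → Fin k) (t : Term L k) : Term L k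
  | ex (s : Fin k) (t : Term L k) : Term L k

namespace Term

variable {L : FirstOrder.Language.{u, v}} {k : ℕ}

open Classical in
/-- The value of a term at a `k`-tuple. -/
noncomputable def eval (A : Type a) [L.Structure A] [Fintype A] : Term L k → (Fin k → A) → ℕ
  | one, _ => 1
  | rel R s, x => if Structure.RelMap R.2 (x ∘ s) then 1 else 0
  | eq s t, x => if x s = x t then 1 else 0
  | mul t₁ t₂, x => eval A t₁ x * eval A t₂ x
  | subst i t, x => eval A t (x ∘ i)
  | ex s t, x => ∑ y : A, eval A t (Function.update x s y)

/-- Summation over the variables in a list. -/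
def exList (t : Term L k) : List (Fin k) → Term L k
  | [] => t
  | s :: l => ex s (exList t l)

/-- The conjunction of a list of equations. -/
def eqList : List (Fin k × Fin k) → Term L k
  | [] => one
  | p :: l => mul (eq p.1 p.2) (eqList l)

variable (A : Type a) [L.Structure A] [Fintype A]

open Classical in
theorem eval_eqList (l : List (Fin k × Fin k)) (x : Fin k → A) :
    eval A (eqList (L := L) l) x = if ∀ p ∈ l, x p.1 = x p.2 then 1 else 0 := by
  induction l with
  | nil => simp [eqList, eval]
  | cons p l ih =>
    by_cases h : x p.1 = x p.2 <;> simp [eqList, eval, ih, h]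

open Classical in
-- Without `hl` a repeated variable would be summed twice and contribute a spurious factor |A|.
theorem eval_exList (t : Term L k) (l : List (Fin k)) (hl : l.Nodup) (x : Fin k → A) :
    eval A (exList t l) x = ∑ z : Fin k → A, if ∀ u, u ∉ l → z u = x u then eval A t z else 0 := by
  induction l generalizing x with
  | nil => simp [exList, ← funext_iff]
  | cons s l ih =>
    obtain ⟨hs, hl⟩ := List.nodup_cons.1 hl
    simp only [exList, eval, ih hl]
    rw [Finset.sum_comm]
    refine Finset.sum_congr rfl fun z _ => ?_
    rw [Finset.sum_eq_single (z s)]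
    · refine if_congr ⟨fun h w hw => ?_, fun h w hw => ?_⟩ rfl rfl
      · have := h w (fun h' => hw (List.mem_cons_of_mem _ h'))
        rwa [Function.update_of_ne (fun e => hw (by simp [e]))] at this
      · by_cases e : w = s
        · subst e; simp
        · rw [Function.update_of_ne e]; exact h w (by simp [e, hw])
    · intro y _ hy
      refine if_neg fun h => hy ?_
      simpa using (h s hs).symm
    · simp

open Classical in
/-- Summation over the fibres of the map `z ↦ z ∘ i`. -/
noncomputable def push (i : Fin k → Fin k) (t : Term L k) : Term L k :=
  mul (eqList (Finset.univ.filter fun p : Fin k × Fin k => i p.1 = i p.2).toList)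
    (subst (fun u => if h : ∃ s, i s = u then h.choose else u)
      (exList t (Finset.univ.filter fun u => ¬ ∃ s, i s = u).toList))

open Classical in
-- The fibre over `x` is empty unless `x` is constant on the fibres of `i`, which the equations
-- test. Otherwise its members are prescribed on the range of `i`, through a section of `i`, and
-- free elsewhere. The default value of the section off the range is harmless, since those positions
-- are summed over.
theorem eval_push (i : Fin k → Fin k) (t : Term L k) (x : Fin k → A) :
    eval A (push i t) x = ∑ z : Fin k → A, if z ∘ i = x then eval A t z else 0 := by
  simp only [push, eval, eval_eqList, eval_exList A t _ (Finset.nodup_toList _), Finset.mem_toList,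
    Finset.mem_filter, Finset.mem_univ, true_and, Prod.forall, not_not, Function.comp_apply]
  have hσ : ∀ s, i (if h : ∃ s', i s' = i s then h.choose else i s) = i s := fun s => by
    have h : ∃ s', i s' = i s := ⟨s, rfl⟩
    rw [dif_pos h]; exact h.choose_spec
  split_ifs with h
  · rw [one_mul]
    refine Finset.sum_congr rfl fun z _ => if_congr ⟨fun hz => ?_, fun hz => ?_⟩ rfl rfl
    · funext s
      rw [Function.comp_apply, hz _ ⟨s, rfl⟩]
      exact h _ _ (hσ s)
    · rintro _ ⟨s, rfl⟩
      rw [← hz, Function.comp_apply, hσ]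
  · rw [zero_mul, Finset.sum_eq_zero]
    intro z _
    refine if_neg fun hz => h fun s s' e => ?_
    simp [← hz, e]

end Term

end RelWL

namespace RelWL

open FirstOrder FirstOrder.Language

/-! ### Connected sets of nodes in trees -/

/-- There is a walk from `x` to `y` inside `S`. -/
def Linked {V : Type*} (G : SimpleGraph V) (S : Set V) (x y : V) : Prop :=
  ∃ p : G.Walk x y, ∀ w ∈ p.support, w ∈ S

namespace Linked

variable {V : Type*} {G : SimpleGraph V} {S : Set V} {x y z : V}

theorem refl (h : x ∈ S) : Linked G S x x := ⟨.nil, by simpa using h⟩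

theorem symm (h : Linked G S x y) : Linked G S y x := by
  obtain ⟨p, hp⟩ := h
  exact ⟨p.reverse, by simpa using hp⟩

theorem trans (h : Linked G S x y) (h' : Linked G S y z) : Linked G S x z := by
  obtain ⟨p, hp⟩ := h
  obtain ⟨p', hp'⟩ := h'
  refine ⟨p.append p', fun w hw => ?_⟩
  rcases SimpleGraph.Walk.mem_support_append_iff _ _ |>.1 hw with hw | hw
  exacts [hp w hw, hp' w hw]

theorem of_adj (h : G.Adj x y) (hx : x ∈ S) (hy : y ∈ S) : Linked G S x y :=
  ⟨h.toWalk, by simp [hx, hy]⟩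

theorem map {V' : Type*} {G' : SimpleGraph V'} (f : G →g G') {S' : Set V'} (h : Linked G S x y)
    (hS : ∀ w ∈ S, f w ∈ S') : Linked G' S' (f x) (f y) := by
  obtain ⟨p, hp⟩ := h
  refine ⟨p.map f, fun w hw => ?_⟩
  rw [SimpleGraph.Walk.support_map, List.mem_map] at hw
  obtain ⟨w, hw, rfl⟩ := hw
  exact hS w (hp w hw)

theorem mono {S' : Set V} (h : Linked G S x y) (hS : S ⊆ S') : Linked G S' x y := by
  obtain ⟨p, hp⟩ := h
  exact ⟨p, fun w hw => hS (hp w hw)⟩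

/-- Paths in a forest are unique, so the path is the shortcut of any walk inside `S`.
Path-closedness of bags can therefore be checked by concatenating walks. -/
theorem mem_of_isPath (h : Linked G S x y) (hG : G.IsAcyclic) (p : G.Walk x y) (hp : p.IsPath) :
    ∀ w ∈ p.support, w ∈ S := by
  classical
  obtain ⟨r, hr⟩ := h
  have : p = r.bypass :=
    congrArg Subtype.val ((hG.subsingleton_path _ _).elim ⟨p, hp⟩ ⟨r.bypass, r.bypass_isPath⟩)
  subst this
  exact fun w hw => hr w (r.support_bypass_subset_support hw)

end Linked

/-- The graph obtained from `G` by attaching a new node `0` to the node `w`. -/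
def addLeaf {n : ℕ} (G : SimpleGraph (Fin n)) (w : Fin n) : SimpleGraph (Fin (n + 1)) :=
  G.map (Fin.succEmb n) ⊔ SimpleGraph.edge 0 w.succ

theorem addLeaf_adj_zero {n : ℕ} (G : SimpleGraph (Fin n)) (w : Fin n) :
    (addLeaf G w).Adj 0 w.succ := by
  simp [addLeaf, SimpleGraph.edge_adj, (Fin.succ_ne_zero w).symm]

/-- The inclusion of `G` into the graph with a new leaf. -/
def addLeafHom {n : ℕ} (G : SimpleGraph (Fin n)) (w : Fin n) : G →g addLeaf G w where
  toFun := Fin.succ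
  map_rel' {x y} h := by
    rw [addLeaf, SimpleGraph.sup_adj]
    exact Or.inl ((SimpleGraph.map_adj_apply (f := Fin.succEmb n)).2 h)

/-- Connectedness is kept, and both the number of nodes and the number of edges grow by one: the new
edge contains 0, which is not a successor. -/
theorem addLeaf_isTree {n : ℕ} {G : SimpleGraph (Fin n)} (hG : G.IsTree) (w : Fin n) :
    (addLeaf G w).IsTree := by
  rw [SimpleGraph.isTree_iff_connected_and_card] at hG ⊢
  obtain ⟨hc, hn⟩ := hG
  constructor
  · have h0 : ∀ x, (addLeaf G w).Reachable 0 x := by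
      intro x
      refine Fin.cases (SimpleGraph.Reachable.refl _) (fun y => ?_) x
      exact (addLeaf_adj_zero G w).reachable.trans ((hc w y).map (addLeafHom G w))
    exact ⟨fun x y => (h0 x).symm.trans (h0 y)⟩
  · have hne : (0 : Fin (n + 1)) ≠ w.succ := (Fin.succ_ne_zero w).symm
    rw [addLeaf, SimpleGraph.edgeSet_sup, SimpleGraph.edgeSet_map, SimpleGraph.edgeSet_edge_of_ne hne,
      Nat.card_coe_set_eq, Set.ncard_union_eq, Set.ncard_image_of_injective _
      (Function.Embedding.injective _), Set.ncard_singleton, ← Nat.card_coe_set_eq, hn]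
    · simp
    · rw [Set.disjoint_singleton_right]
      rintro ⟨e, _, he⟩
      have : (0 : Fin (n + 1)) ∈ (Fin.succEmb n).sym2Map e := by rw [he]; simp
      rw [Function.Embedding.sym2Map_apply, Sym2.mem_map] at this
      obtain ⟨y, _, hy⟩ := this
      exact Fin.succ_ne_zero y hy

/-! ### Homomorphisms -/

/-- The map `h` preserves all relations. -/
def IsHom (L : FirstOrder.Language.{u, v}) {Q : Type q} {A : Type a} [L.Structure Q] [L.Structure A]
    (h : Q → A) : Prop :=
  ∀ (R : Sym L) (x : Fin R.1 → Q), Structure.RelMap R.2 x → Structure.RelMap R.2 (h ∘ x)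

/-- Homomorphisms of relational structures are the maps that preserve all relations. -/
def homEquiv (L : FirstOrder.Language.{u, v}) [L.IsRelational] (Q : Type q) (A : Type a)
    [L.Structure Q] [L.Structure A] : (Q →[L] A) ≃ {h : Q → A // IsHom L h} where
  toFun h := ⟨h, fun R x hx => h.map_rel' R.2 x hx⟩
  invFun h := ⟨h.1, fun f => isEmptyElim f, fun R x hx => h.2 ⟨_, R⟩ x hx⟩
  left_inv _ := rfl
  right_inv _ := rfl

/-- The smallest structure on `Q'` for which `ι` is a homomorphism. -/
@[reducible]
def pushStructure (L : FirstOrder.Language.{u, v}) [L.IsRelational] {Q : Type q} [L.Structure Q]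
    {Q' : Type q} (ι : Q → Q') : L.Structure Q' where
  funMap f := isEmptyElim f
  RelMap R x := ∃ y, x = ι ∘ y ∧ Structure.RelMap R y

theorem isHom_pushStructure {L : FirstOrder.Language.{u, v}} [L.IsRelational] {Q : Type q}
    [L.Structure Q] {Q' : Type q} (ι : Q → Q') {A : Type a} [L.Structure A] (h : Q' → A) :
    (letI := pushStructure L ι; IsHom L h) ↔ IsHom L (h ∘ ι) := by
  constructor
  · intro H R x hx
    exact H R (ι ∘ x) ⟨x, rfl, hx⟩
  · rintro H R _ ⟨y, rfl, hy⟩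
    exact H R y hy

/-! ### Structures with tree-decompositions of width less than `k` -/

/-- A finite structure with a tree-decomposition of width less than `k`. -/
structure Decomposed (L : FirstOrder.Language.{u, v}) (k : ℕ) : Type (max u v (q + 1)) where
  Q : Type q
  [str : L.Structure Q]
  [finite : Finite Q]
  D : TreeDecomposition L Q
  card_le : ∀ w, (D.bag w).card ≤ k

attribute [instance] Decomposed.str Decomposed.finite

theorem TreeDecomposition.width_lt_iff {L : FirstOrder.Language.{u, v}} {A : Type a} [L.Structure A]
    (D : TreeDecomposition L A) (k : ℕ) : D.width < (k : ℤ) ↔ ∀ w, (D.bag w).card ≤ k := by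
  rw [TreeDecomposition.width]
  have : (((Finset.univ.sup fun w => (D.bag w).card : ℕ) : ℤ) - 1 < k) ↔
    (Finset.univ.sup fun w => (D.bag w).card) ≤ k := by omega
  rw [this, Finset.sup_le_iff]
  simp

theorem TreeDecomposition.linked {L : FirstOrder.Language.{u, v}} {A : Type a} [L.Structure A]
    (D : TreeDecomposition L A) {x : A} {w₁ w₂ : Fin D.n} (h₁ : x ∈ D.bag w₁) (h₂ : x ∈ D.bag w₂) :
    Linked D.G {w | x ∈ D.bag w} w₁ w₂ := by
  classical
  obtain ⟨p⟩ := D.isTree.connected w₁ w₂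
  exact ⟨p.bypass, D.mem_of_path x w₁ w₂ _ p.bypass_isPath h₁ h₂⟩

/-- The tree-decomposition with a single bag. -/
def TreeDecomposition.single (L : FirstOrder.Language.{u, v}) (A : Type a) [L.Structure A]
    [Fintype A] : TreeDecomposition L A where
  n := 1
  G := ⊥
  isTree := SimpleGraph.IsTree.of_subsingleton
  bag _ := Finset.univ
  constraint_subset _ := ⟨0, by simp⟩
  mem_of_path := by simp

/-- The infimum in ℤ is meaningful because the one-bag decomposition exists and every width is at
least -1. -/
theorem treewidth_lt_iff (L : FirstOrder.Language.{u, v}) (Q : Type q) [L.Structure Q] [Finite Q]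
    (k : ℕ) : treewidth L Q < (k : ℤ) ↔
      ∃ D : TreeDecomposition L Q, ∀ w, (D.bag w).card ≤ k := by
  simp only [← TreeDecomposition.width_lt_iff]
  constructor
  · intro h
    have := Fintype.ofFinite Q
    obtain ⟨_, ⟨D, rfl⟩, hD⟩ := exists_lt_of_csInf_lt
      (Set.range_nonempty_iff_nonempty.2 ⟨TreeDecomposition.single L Q⟩) h
    exact ⟨D, hD⟩
  · rintro ⟨D, hD⟩
    refine lt_of_le_of_lt (csInf_le ⟨-1, ?_⟩ ⟨D, rfl⟩) hD
    rintro _ ⟨D, rfl⟩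
    simp only [TreeDecomposition.width]
    omega

namespace Decomposed

variable {L : FirstOrder.Language.{u, v}} {k : ℕ}

/-- The structure with an additional constraint. -/
@[reducible]
def addRelStructure {Q : Type q} (str : L.Structure Q) (R : Sym L) (y : Fin R.1 → Q) :
    L.Structure Q where
  funMap f := Structure.funMap f
  RelMap {n} R' x := Structure.RelMap R' x ∨
    (⟨⟨n, R'⟩, x⟩ : Σ S : Sym L, Fin S.1 → Q) = ⟨R, y⟩

/-- Adding a constraint inside a bag. -/
def addRel (P : Decomposed.{u, v, q} L k) (R : Sym L) (y : Fin R.1 → P.Q)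
    (hy : ∃ w, ∀ i, y i ∈ P.D.bag w) : Decomposed.{u, v, q} L k where
  Q := P.Q
  str := addRelStructure P.str R y
  D := @TreeDecomposition.mk _ _ (addRelStructure P.str R y) P.D.n P.D.G P.D.isTree P.D.bag
    (by
      rintro ⟨R', x, h | h⟩
      · exact P.D.constraint_subset ⟨R', x, h⟩
      · cases h
        exact hy)
    P.D.mem_of_path
  card_le := P.card_le

theorem isHom_addRel (P : Decomposed.{u, v, q} L k) (R : Sym L) (y : Fin R.1 → P.Q)
    (hy : ∃ w, ∀ i, y i ∈ P.D.bag w) {A : Type a} [L.Structure A] (h : P.Q → A) :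
    IsHom L (Q := (P.addRel R y hy).Q) h ↔ IsHom L h ∧ Structure.RelMap R.2 (h ∘ y) := by
  constructor
  · exact fun H => ⟨fun R' x hx => H R' x (Or.inl hx), H R y (Or.inr rfl)⟩
  · rintro ⟨H, H'⟩ R' x (hx | hx)
    · exact H R' x hx
    · cases hx
      exact H'

variable [L.IsRelational]

open Classical in
/-- Identifying two elements `x`, `y` in the same bag. -/
noncomputable def identify (P : Decomposed.{u, v, q} L k) (x y : P.Q)
    (hxy : ∃ w, x ∈ P.D.bag w ∧ y ∈ P.D.bag w) : Decomposed.{u, v, q} L k where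
  Q := Set.range fun z => if z = y then x else z
  str := pushStructure L (Set.rangeFactorization fun z => if z = y then x else z)
  D := letI := pushStructure L (Set.rangeFactorization fun z => if z = y then x else z)
    { n := P.D.n
      G := P.D.G
      isTree := P.D.isTree
      bag := fun w => (P.D.bag w).image (Set.rangeFactorization _)
      constraint_subset := by
        rintro ⟨R, _, z, rfl, hz⟩
        obtain ⟨w, hw⟩ := P.D.constraint_subset ⟨R, z, hz⟩
        exact ⟨w, fun i => Finset.mem_image_of_mem _ (hw i)⟩
      mem_of_path := by
        intro z w₁ w₂ p hp h₁ h₂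
        refine Linked.mem_of_isPath (S := {w | z ∈ (P.D.bag w).image (Set.rangeFactorization _)})
          ?_ P.D.isTree.isAcyclic p hp
        rw [Finset.mem_image] at h₁ h₂
        obtain ⟨z₁, h₁, rfl⟩ := h₁
        obtain ⟨z₂, h₂, e⟩ := h₂
        obtain ⟨w, hx, hy⟩ := hxy
        have hsub : ∀ z', Set.rangeFactorization (fun z => if z = y then x else z) z' =
            Set.rangeFactorization _ z₁ → {w | z' ∈ P.D.bag w} ⊆
            {w | Set.rangeFactorization (fun z => if z = y then x else z) z₁ ∈
              (P.D.bag w).image (Set.rangeFactorization _)} :=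
          fun z' e w hw => e ▸ Finset.mem_image_of_mem _ hw
        have e' := congrArg Subtype.val e
        simp only [Set.rangeFactorization] at e'
        -- Distinct preimages of one element are `x` and `y`; the walks of the two are joined at the
        -- common bag `w`.
        by_cases h : z₁ = z₂
        · subst h
          exact (P.D.linked h₁ h₂).mono (hsub _ rfl)
        · have hz : ∀ z', z' = x ∨ z' = y → z' ∈ P.D.bag w := by
            rintro _ (rfl | rfl) <;> assumption
          have h₁' : z₁ = x ∨ z₁ = y := by split_ifs at e' <;> simp_all
          have h₂' : z₂ = x ∨ z₂ = y := by split_ifs at e' <;> simp_all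
          exact ((P.D.linked h₁ (hz _ h₁')).mono (hsub _ rfl)).trans
            ((P.D.linked (hz _ h₂') h₂).mono (hsub _ e)) }
  card_le w := Finset.card_image_le.trans (P.card_le w)

open Classical in
/-- Adding a new element, in a new bag, that consists of the values of `p'`. -/
noncomputable def addElement (P : Decomposed.{u, v, q} L k) (p : Fin k → Option P.Q) (w : Fin P.D.n)
    (hp : ∀ s, ∀ x ∈ p s, x ∈ P.D.bag w) : Decomposed.{u, v, q} L k where
  Q := Option P.Q
  str := pushStructure L some
  D := letI := pushStructure L (some : P.Q → Option P.Q)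
    { n := P.D.n + 1
      G := addLeaf P.D.G w
      isTree := addLeaf_isTree P.D.isTree w
      bag := Fin.cons (Finset.univ.image p) fun w => (P.D.bag w).image some
      constraint_subset := by
        rintro ⟨R, _, z, rfl, hz⟩
        obtain ⟨w, hw⟩ := P.D.constraint_subset ⟨R, z, hz⟩
        exact ⟨w.succ, fun i => Finset.mem_image_of_mem _ (hw i)⟩
      mem_of_path := by
        intro z w₁ w₂ p' hp' h₁ h₂
        refine Linked.mem_of_isPath (S := {w' | z ∈ (Fin.cons (Finset.univ.image p)
          fun w => (P.D.bag w).image some : Fin (P.D.n + 1) → Finset (Option P.Q)) w'})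
          ?_ (addLeaf_isTree P.D.isTree w).isAcyclic p' hp'
        clear hp' p'
        have key : ∀ (x : P.Q) (w₁ w₂ : Fin P.D.n), x ∈ P.D.bag w₁ → x ∈ P.D.bag w₂ →
            Linked (addLeaf P.D.G w) {w' | some x ∈ (Fin.cons (Finset.univ.image p)
              fun w => (P.D.bag w).image some : Fin (P.D.n + 1) → Finset (Option P.Q)) w'}
              w₁.succ w₂.succ := fun x w₁ w₂ h₁ h₂ =>
          (P.D.linked h₁ h₂).map (addLeafHom _ _) fun w hw => Finset.mem_image_of_mem some hw
        -- An old element of the new bag also lies in the bag of `w`, by `hp`, so the walk leaves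
        -- the leaf through its only edge.
        have key₀ : ∀ (z : Option P.Q) (w₁ : Fin P.D.n), z ∈ Finset.univ.image p →
            z ∈ (P.D.bag w₁).image some →
            Linked (addLeaf P.D.G w) {w' | z ∈ (Fin.cons (Finset.univ.image p)
              fun w => (P.D.bag w).image some : Fin (P.D.n + 1) → Finset (Option P.Q)) w'}
              0 w₁.succ := by
          intro z w₁ h₀ h₁
          obtain ⟨x, hx, rfl⟩ := Finset.mem_image.1 h₁
          obtain ⟨s, _, hs⟩ := Finset.mem_image.1 h₀
          have hw : x ∈ P.D.bag w := hp s x hs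
          exact (Linked.of_adj (addLeaf_adj_zero _ _) h₀ (Finset.mem_image_of_mem some hw)).trans
            (key x w w₁ hw hx)
        revert h₁ h₂
        refine Fin.cases ?_ (fun w₁ => ?_) w₁ <;> refine Fin.cases ?_ (fun w₂ => ?_) w₂
        · exact fun h _ => Linked.refl h
        · exact fun h₁ h₂ => key₀ z w₂ h₁ h₂
        · exact fun h₁ h₂ => (key₀ z w₁ h₂ h₁).symm
        · intro h₁ h₂
          obtain ⟨x, hx, rfl⟩ := Finset.mem_image.1 h₁
          obtain ⟨x', hx', e⟩ := Finset.mem_image.1 h₂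
          cases e
          exact key x w₁ w₂ hx hx' }
  card_le w := by
    refine Fin.cases ?_ (fun w => ?_) w
    · exact Finset.card_image_le.trans (by simp)
    · exact Finset.card_image_le.trans (P.card_le w)

/-- The structure on `k` elements without constraints. -/
def discrete (L : FirstOrder.Language.{u, v}) [L.IsRelational] (k : ℕ) : Decomposed.{u, v, q} L k :=
  letI : L.Structure (ULift.{q} (Fin k)) :=
    { funMap := fun f => isEmptyElim f, RelMap := fun _ _ => False }
  { Q := ULift.{q} (Fin k)
    D := TreeDecomposition.single L _
    card_le := fun _ => by simp [TreeDecomposition.single] }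

end Decomposed

end RelWL

/-! ### Realizing terms by extensions of decomposed structures -/

namespace RelWL

open FirstOrder FirstOrder.Language

namespace Decomposed

variable {L : FirstOrder.Language.{u, v}} {k : ℕ}

noncomputable instance (P : Decomposed.{u, v, q} L k) : Fintype P.Q := Fintype.ofFinite _

/-- The number of homomorphisms `P' → A` that extend `h` along `ι`. -/
noncomputable def extCount (P P' : Decomposed.{u, v, q} L k) (ι : P.Q → P'.Q) {A : Type a}
    [L.Structure A] (h : P.Q → A) : ℕ :=
  Nat.card {h' : P'.Q → A // IsHom L h' ∧ h' ∘ ι = h}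

variable {A : Type a} [L.Structure A] [Fintype A]

open Classical in
theorem extCount_eq_sum (P P' : Decomposed.{u, v, q} L k) (ι : P.Q → P'.Q) (h : P.Q → A) :
    extCount P P' ι h = ∑ h' : P'.Q → A, if IsHom L h' ∧ h' ∘ ι = h then 1 else 0 := by
  rw [extCount, Nat.card_eq_fintype_card, Fintype.card_subtype, Finset.card_filter]

open Classical in
-- The maps on `P₂` are sorted by their restriction along `ι₂`.
theorem extCount_comp (P₀ P₁ P₂ : Decomposed.{u, v, q} L k) (ι₁ : P₀.Q → P₁.Q) (ι₂ : P₁.Q → P₂.Q)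
    (h : P₀.Q → A) : extCount P₀ P₂ (ι₂ ∘ ι₁) h =
      ∑ h₁ : P₁.Q → A, if h₁ ∘ ι₁ = h then extCount P₁ P₂ ι₂ h₁ else 0 := by
  simp only [extCount_eq_sum]
  have : ∀ h₁ : P₁.Q → A, (if h₁ ∘ ι₁ = h then
      ∑ h' : P₂.Q → A, (if IsHom L h' ∧ h' ∘ ι₂ = h₁ then 1 else 0) else 0) =
      ∑ h' : P₂.Q → A, if h₁ ∘ ι₁ = h ∧ IsHom L h' ∧ h' ∘ ι₂ = h₁ then 1 else 0 := by
    intro h₁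
    by_cases e : h₁ ∘ ι₁ = h <;> simp [e]
  rw [Finset.sum_congr rfl fun h₁ _ => this h₁, Finset.sum_comm]
  refine Finset.sum_congr rfl fun h' _ => ?_
  rw [Finset.sum_eq_single (h' ∘ ι₂)]
  · refine if_congr ?_ rfl rfl
    simp only [Function.comp_assoc]
    tauto
  · intro h₁ _ hne
    exact if_neg fun H => hne H.2.2.symm
  · simp

open Classical in
/-- The extension `ι` of `P` multiplies the numbers of homomorphisms with the values of `t`. -/
def Realizes (A : Type a) [L.Structure A] [Fintype A] (t : Term L k) (P P' : Decomposed.{u, v, q} L k)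
    (p : Fin k → P.Q) (ι : P.Q → P'.Q) : Prop :=
  ∀ h : P.Q → A, extCount P P' ι h = if IsHom L h then t.eval A (h ∘ p) else 0

/-- The map `ι` sends bags into bags. -/
def BagMap (P P' : Decomposed.{u, v, q} L k) (ι : P.Q → P'.Q) : Prop :=
  ∀ w, ∃ w', ∀ x ∈ P.D.bag w, ι x ∈ P'.D.bag w'

/-- The term `t` is realized by extensions of arbitrary structures of treewidth less than `k`,
simultaneously for `A` and `B`. -/
def Realizable (A : Type a) [L.Structure A] [Fintype A] (B : Type b) [L.Structure B] [Fintype B]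
    (t : Term L k) : Prop :=
  ∀ (P : Decomposed.{u, v, q} L k) (p : Fin k → P.Q), (∃ w, ∀ s, p s ∈ P.D.bag w) →
    ∃ (P' : Decomposed.{u, v, q} L k) (ι : P.Q → P'.Q),
      BagMap P P' ι ∧ Realizes A t P P' p ι ∧ Realizes B t P P' p ι

theorem BagMap.comp {P₀ P₁ P₂ : Decomposed.{u, v, q} L k} {ι₁ : P₀.Q → P₁.Q} {ι₂ : P₁.Q → P₂.Q}
    (h₂ : BagMap P₁ P₂ ι₂) (h₁ : BagMap P₀ P₁ ι₁) : BagMap P₀ P₂ (ι₂ ∘ ι₁) := by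
  intro w
  obtain ⟨w₁, hw₁⟩ := h₁ w
  obtain ⟨w₂, hw₂⟩ := h₂ w₁
  exact ⟨w₂, fun x hx => hw₂ _ (hw₁ x hx)⟩

theorem BagMap.exists_bag {P₀ P₁ : Decomposed.{u, v, q} L k} {ι : P₀.Q → P₁.Q} (h : BagMap P₀ P₁ ι)
    {p : Fin k → P₀.Q} (hp : ∃ w, ∀ s, p s ∈ P₀.D.bag w) : ∃ w, ∀ s, (ι ∘ p) s ∈ P₁.D.bag w := by
  obtain ⟨w, hw⟩ := hp
  obtain ⟨w', hw'⟩ := h w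
  exact ⟨w', fun s => hw' _ (hw s)⟩

theorem realizes_one (P : Decomposed.{u, v, q} L k) (p : Fin k → P.Q) :
    Realizes A Term.one P P p id := by
  classical
  intro h
  rw [extCount_eq_sum, Finset.sum_eq_single h]
  · exact if_congr (and_iff_left rfl) rfl rfl
  · intro h' _ hne
    exact if_neg fun H => hne H.2
  · simp

theorem realizes_rel (P : Decomposed.{u, v, q} L k) (p : Fin k → P.Q) (R : Sym L)
    (s : Fin R.1 → Fin k) (hp : ∃ w, ∀ i, (p ∘ s) i ∈ P.D.bag w) :
    Realizes A (Term.rel R s) P (P.addRel R (p ∘ s) hp) p id := by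
  classical
  intro h
  refine (extCount_eq_sum P (P.addRel R (p ∘ s) hp) id h).trans ?_
  refine (Finset.sum_eq_single (h : (P.addRel R (p ∘ s) hp).Q → A) ?_
    fun H => (H (Finset.mem_univ _)).elim).trans ?_
  · intro h' _ hne
    exact if_neg fun H => hne H.2
  · rw [Term.eval, ← ite_and]
    exact if_congr ((and_iff_left rfl).trans (isHom_addRel P R (p ∘ s) hp h)) rfl rfl

/-- The second extension is built on top of the first, in place of gluing two structures along the
tuple. This is why realizability is demanded over every base structure. -/
theorem realizes_mul {P₀ P₁ P₂ : Decomposed.{u, v, q} L k} {t₁ t₂ : Term L k} {p : Fin k → P₀.Q}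
    {ι₁ : P₀.Q → P₁.Q} {ι₂ : P₁.Q → P₂.Q} (h₁ : Realizes A t₁ P₀ P₁ p ι₁)
    (h₂ : Realizes A t₂ P₁ P₂ (ι₁ ∘ p) ι₂) : Realizes A (t₁.mul t₂) P₀ P₂ p (ι₂ ∘ ι₁) := by
  classical
  intro h
  rw [extCount_comp]
  have : ∀ h₁ : P₁.Q → A, (if h₁ ∘ ι₁ = h then extCount P₁ P₂ ι₂ h₁ else 0) =
      (if IsHom L h₁ ∧ h₁ ∘ ι₁ = h then 1 else 0) * t₂.eval A (h ∘ p) := by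
    intro h₁
    rw [h₂ h₁]
    by_cases e : h₁ ∘ ι₁ = h
    · rw [← Function.comp_assoc, e]
      by_cases H : IsHom L h₁ <;> simp [H]
    · simp [e]
  rw [Finset.sum_congr rfl fun h₁ _ => this h₁, ← Finset.sum_mul, ← extCount_eq_sum, h₁ h]
  by_cases H : IsHom L h <;> simp [H, Term.eval]

variable [L.IsRelational]

/-- A homomorphism factors through the quotient, in exactly one way, iff it takes equal values at
the two identified elements. -/
theorem realizes_eq (P : Decomposed.{u, v, q} L k) (p : Fin k → P.Q) (s t : Fin k)
    (hp : ∃ w, p s ∈ P.D.bag w ∧ p t ∈ P.D.bag w) :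
    Realizes A (Term.eq s t) P (P.identify (p s) (p t) hp) p (Set.rangeFactorization _) := by
  classical
  intro h
  simp only [Term.eval, Function.comp_apply, ← ite_and]
  set ι : P.Q → (P.identify (p s) (p t) hp).Q :=
    Set.rangeFactorization fun z => if z = p t then p s else z with hι
  have hsurj : Function.Surjective ι := Set.rangeFactorization_surjective
  have hhom : ∀ h' : (P.identify (p s) (p t) hp).Q → A, IsHom L h' ↔ IsHom L (h' ∘ ι) :=
    fun h' => isHom_pushStructure ι h'
  rw [extCount_eq_sum]
  split_ifs with H
  · obtain ⟨H, e⟩ := H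
    have hval : ∀ z, (ι z).1 = if z = p t then p s else z := fun _ => rfl
    have hfac : ((fun z => h z.1) : (P.identify (p s) (p t) hp).Q → A) ∘ ι = h := by
      funext z
      by_cases hz : z = p t
      · exact (congrArg h ((hval z).trans (if_pos hz))).trans (by rw [hz, e])
      · exact congrArg h ((hval z).trans (if_neg hz))
    -- Elements of the quotient are representatives in `P.Q`, so the only candidate is the
    -- restriction of `h`.
    rw [Finset.sum_eq_single (fun z => h z.1)]
    · rw [if_pos ⟨(hhom _).2 (by rwa [hfac]), hfac⟩]
    · intro h' _ hne
      refine if_neg fun H' => hne (hsurj.injective_comp_right (H'.2.trans hfac.symm))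
    · simp
  · refine Finset.sum_eq_zero fun h' _ => if_neg ?_
    rintro ⟨H', rfl⟩
    refine H ⟨(hhom _).1 H', ?_⟩
    have : ι (p s) = ι (p t) := by
      apply Subtype.ext
      simp [hι, Set.rangeFactorization]
    simp [this]

/-- The new element carries no constraint, so a homomorphism extends to it by an arbitrary value
`y`; these values give the summands. -/
theorem realizes_ex {P : Decomposed.{u, v, q} L k} {p : Fin k → P.Q} {s : Fin k} {w : Fin P.D.n}
    {hp : ∀ u, ∀ x ∈ Function.update (some ∘ p) s none u, x ∈ P.D.bag w} {t : Term L k}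
    {P₂ : Decomposed.{u, v, q} L k} {ι₂ : Option P.Q → P₂.Q}
    (h₂ : Realizes A t (P.addElement (Function.update (some ∘ p) s none) w hp) P₂
      (Function.update (some ∘ p) s none) ι₂) :
    Realizes A (Term.ex s t) P P₂ p (ι₂ ∘ some) := by
  classical
  intro h
  set P₁ := P.addElement (Function.update (some ∘ p) s none) w hp with hP₁
  have hhom : ∀ h' : P₁.Q → A, IsHom L h' ↔ IsHom L (h' ∘ (some : P.Q → Option P.Q)) :=
    fun h' => isHom_pushStructure (some : P.Q → Option P.Q) h'
  refine (extCount_comp P P₁ P₂ (some : P.Q → Option P.Q) ι₂ h).trans ?_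
  have : ∀ h₁ : P₁.Q → A, (if h₁ ∘ (some : P.Q → Option P.Q) = h then extCount P₁ P₂ ι₂ h₁ else 0) =
      if h₁ ∘ (some : P.Q → Option P.Q) = h then (if IsHom L h then
        t.eval A (h₁ ∘ Function.update (some ∘ p) s none) else 0) else 0 := by
    intro h₁
    split_ifs with e H
    · rw [h₂ h₁, if_pos ((hhom _).2 (by rwa [e]))]
    · rw [h₂ h₁, if_neg (fun H' => H (by rw [← e]; exact (hhom _).1 H'))]
    · rfl
  rw [Finset.sum_congr rfl fun h₁ _ => this h₁]
  split_ifs with H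
  · rw [Term.eval, ← Finset.sum_filter]
    symm
    refine Finset.sum_bij (fun (y : A) _ => ((fun z => z.elim y h : Option P.Q → A) : P₁.Q → A))
      ?_ ?_ ?_ ?_
    · intro y _
      exact Finset.mem_filter.2 ⟨Finset.mem_univ _, rfl⟩
    · intro y _ y' _ e
      exact congrFun e (none : Option P.Q)
    · intro h₁ hh₁
      rw [Finset.mem_filter] at hh₁
      refine ⟨h₁ (none : Option P.Q), Finset.mem_univ _, ?_⟩
      funext z
      rcases (z : Option P.Q) with _ | z
      · rfl
      · exact (congrFun hh₁.2 z).symm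
    · intro y _
      refine congrArg (t.eval A) (funext fun u => ?_)
      change _ = (Function.update (some ∘ p) s none u : Option P.Q).elim y h
      by_cases hu : u = s
      · subst hu
        simp
      · simp [hu]
  · simp

theorem realizable {B : Type b} [L.Structure B] [Fintype B] (t : Term L k) :
    Realizable.{u, v, a, b, q} A B t := by
  classical
  induction t with
  | one => exact fun P p _ => ⟨P, id, fun w => ⟨w, fun _ h => h⟩, realizes_one P p, realizes_one P p⟩
  | rel R s =>
    intro P p hp
    have hp' : ∃ w, ∀ i, (p ∘ s) i ∈ P.D.bag w := hp.imp fun w hw i => hw (s i)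
    exact ⟨P.addRel R (p ∘ s) hp', id, fun w => ⟨w, fun _ h => h⟩, realizes_rel P p R s hp',
      realizes_rel P p R s hp'⟩
  | eq s t =>
    intro P p hp
    have hp' : ∃ w, p s ∈ P.D.bag w ∧ p t ∈ P.D.bag w := hp.imp fun w hw => ⟨hw s, hw t⟩
    exact ⟨P.identify (p s) (p t) hp', Set.rangeFactorization _,
      fun w => ⟨w, fun x hx => @Finset.mem_image_of_mem _ _ (_) _ _ _ hx⟩, realizes_eq P p s t hp',
      realizes_eq P p s t hp'⟩
  | mul t₁ t₂ ih₁ ih₂ =>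
    intro P p hp
    obtain ⟨P₁, ι₁, hb₁, hA₁, hB₁⟩ := ih₁ P p hp
    obtain ⟨P₂, ι₂, hb₂, hA₂, hB₂⟩ := ih₂ P₁ (ι₁ ∘ p) (hb₁.exists_bag hp)
    exact ⟨P₂, ι₂ ∘ ι₁, hb₂.comp hb₁, realizes_mul hA₁ hA₂, realizes_mul hB₁ hB₂⟩
  | subst i t ih =>
    intro P p hp
    -- The same extension serves, because `(h ∘ p) ∘ i` is `h ∘ (p ∘ i)`.
    obtain ⟨P₁, ι₁, hb₁, hA₁, hB₁⟩ := ih P (p ∘ i) (hp.imp fun w hw s => hw (i s))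
    exact ⟨P₁, ι₁, hb₁, hA₁, hB₁⟩
  | ex s t ih =>
    intro P p hp
    obtain ⟨w, hw⟩ := hp
    have hp' : ∀ u, ∀ x ∈ Function.update (some ∘ p) s none u, x ∈ P.D.bag w := by
      intro u x hx
      by_cases hu : u = s
      · subst hu
        simp at hx
      · simp only [Function.update_of_ne hu, Function.comp_apply, Option.mem_some_iff] at hx
        exact hx ▸ hw u
    obtain ⟨P₂, ι₂, hb₂, hA₂, hB₂⟩ := ih
      (P.addElement (Function.update (some ∘ p) s none) w hp') (Function.update (some ∘ p) s none)
      ⟨(0 : Fin (P.D.n + 1)), fun s => @Finset.mem_image_of_mem _ _ (_) _ _ _ (Finset.mem_univ s)⟩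
    refine ⟨P₂, ι₂ ∘ (some : P.Q → Option P.Q), hb₂.comp ?_, realizes_ex hA₂, realizes_ex hB₂⟩
    exact fun w => ⟨w.succ, fun x hx => @Finset.mem_image_of_mem _ _ (_) _ _ _ hx⟩

theorem isHom_discrete {A : Type a} [L.Structure A] (h : (discrete.{u, v, q} L k).Q → A) : IsHom L h :=
  fun _ _ h => h.elim

/-- Every map on the discrete structure is a homomorphism, so summing the extension counts over all
k-tuples counts each homomorphism from `P` once. -/
theorem homCount_of_realizes {t : Term L k} {P : Decomposed.{u, v, q} L k}
    {ι : (discrete.{u, v, q} L k).Q → P.Q}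
    (h : Realizes A t (discrete.{u, v, q} L k) P (ULift.up : Fin k → ULift.{q} (Fin k)) ι) :
    homCount L P.Q A = ∑ x : Fin k → A, t.eval A x := by
  classical
  have h₁ : homCount L P.Q A = ∑ h : (discrete.{u, v, q} L k).Q → A, extCount _ P ι h := by
    simp only [extCount_eq_sum]
    rw [Finset.sum_comm, homCount, Nat.card_congr (homEquiv L P.Q A), Nat.card_eq_fintype_card,
      Fintype.card_subtype, Finset.card_filter]
    refine Finset.sum_congr rfl fun h' _ => ?_
    rw [Finset.sum_eq_single (h' ∘ ι)]
    · simp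
    · intro h _ hne
      exact if_neg fun H => hne H.2.symm
    · simp
  rw [h₁]
  let e : ((discrete.{u, v, q} L k).Q → A) ≃ (Fin k → A) :=
    Equiv.arrowCongr (Equiv.ulift : ULift.{q} (Fin k) ≃ Fin k) (Equiv.refl A)
  refine Fintype.sum_equiv e _ _ fun h' => ?_
  rw [h h', if_pos (isHom_discrete h')]
  rfl

/-- If `A` and `B` have the same homomorphism counts from structures of treewidth less than `k`,
then all terms have the same sums over `A` and over `B`. -/
theorem sum_eval_eq {B : Type b} [L.Structure B] [Fintype B]
    (H : ∀ (Q : Type q) [L.Structure Q] [Finite Q],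
        treewidth L Q < (k : ℤ) → homCount L Q A = homCount L Q B) (t : Term L k) :
    ∑ x : Fin k → A, t.eval A x = ∑ x : Fin k → B, t.eval B x := by
  obtain ⟨P, ι, -, hA, hB⟩ := realizable.{u, v, a, b, q} (A := A) (B := B) t (discrete L k)
    (ULift.up : Fin k → ULift.{q} (Fin k)) ⟨(0 : Fin 1), fun s => @Finset.mem_univ _ (_) _⟩
  rw [← homCount_of_realizes hA, ← homCount_of_realizes hB]
  exact H P.Q ((treewidth_lt_iff L P.Q k).2 ⟨P.D, P.card_le⟩)

end Decomposed

end RelWL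

/-! ### Couplings, and the coupling given by equality of term values -/

namespace RelWL

open FirstOrder FirstOrder.Language

open Classical in
/-- A fractional form of a winning position of the bijective pebble game: a doubly stochastic
matrix, indexed by `k`-tuples, that is supported on pairs of the same atomic type and is compatible
with the maps `x ↦ x ∘ i`. -/
structure IsCoupling (L : FirstOrder.Language.{u, v}) {k : ℕ} {A : Type a} {B : Type b}
    [L.Structure A] [L.Structure B] [Fintype A] [Fintype B]
    (X : (Fin k → B) → (Fin k → A) → ℝ) : Prop where
  nonneg : ∀ y x, 0 ≤ X y x
  eq_iff : ∀ y x, X y x ≠ 0 → ∀ s t, y s = y t ↔ x s = x t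
  rel_iff : ∀ y x, X y x ≠ 0 → ∀ (R : Sym L) (s : Fin R.1 → Fin k),
    Structure.RelMap R.2 (y ∘ s) ↔ Structure.RelMap R.2 (x ∘ s)
  push_left : ∀ (i : Fin k → Fin k) (z : Fin k → B) (x : Fin k → A),
    (∑ y, if y ∘ i = z then X y x else 0) = X z (x ∘ i)
  push_right : ∀ (i : Fin k → Fin k) (y : Fin k → B) (z : Fin k → A),
    (∑ x, if x ∘ i = z then X y x else 0) = X (y ∘ i) z
  sum_left : ∀ x, ∑ y, X y x = 1
  sum_right : ∀ y, ∑ x, X y x = 1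

theorem IsCoupling.swap {L : FirstOrder.Language.{u, v}} {k : ℕ} {A : Type a} {B : Type b}
    [L.Structure A] [L.Structure B] [Fintype A] [Fintype B]
    {X : (Fin k → B) → (Fin k → A) → ℝ} (h : IsCoupling L X) :
    IsCoupling L fun x y => X y x where
  nonneg x y := h.nonneg y x
  eq_iff x y hne s t := (h.eq_iff y x hne s t).symm
  rel_iff x y hne R s := (h.rel_iff y x hne R s).symm
  push_left i z y := h.push_right i y z
  push_right i x z := h.push_left i z x
  sum_left := h.sum_right
  sum_right := h.sum_left

namespace Term

variable {L : FirstOrder.Language.{u, v}} {k : ℕ}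

/-- The type of a tuple: the values of all terms. -/
noncomputable def tp (A : Type a) [L.Structure A] [Fintype A] (x : Fin k → A) (t : Term L k) : ℕ :=
  t.eval A x

open Classical in
/-- The number of tuples of type `τ`. -/
noncomputable def count (A : Type a) [L.Structure A] [Fintype A] (τ : Term L k → ℕ) : ℝ :=
  ∑ x : Fin k → A, if tp A x = τ then 1 else 0

open Classical in
/-- The number of tuples of type `τ` in the fibre of `z`. -/
noncomputable def fibre (A : Type a) [L.Structure A] [Fintype A] (τ : Term L k → ℕ)
    (i : Fin k → Fin k) (z : Fin k → A) : ℝ :=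
  ∑ x : Fin k → A, if x ∘ i = z then (if tp A x = τ then 1 else 0) else 0

variable (A : Type a) [L.Structure A] [Fintype A] (B : Type b) [L.Structure B] [Fintype B]

/-- The type of a tuple of `A` or of `B`. -/
noncomputable def tpSum : (Fin k → A) ⊕ (Fin k → B) → Term L k → ℕ :=
  Sum.elim (tp A) (tp B)

/-- The values of a term in `A` and in `B`. -/
noncomputable def ev (t : Term L k) (x : (Fin k → A) ⊕ (Fin k → B)) : ℝ :=
  tpSum A B x t

/-- The linear span of the values of terms. -/
noncomputable def evSpan (L : FirstOrder.Language.{u, v}) (k : ℕ) (A : Type a) [L.Structure A]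
    [Fintype A] (B : Type b) [L.Structure B] [Fintype B] :
    Submodule ℝ ((Fin k → A) ⊕ (Fin k → B) → ℝ) :=
  Submodule.span ℝ (Set.range (ev (L := L) A B))

variable {A B}

theorem ev_mem (t : Term L k) : ev A B t ∈ evSpan L k A B :=
  Submodule.subset_span ⟨t, rfl⟩

theorem one_mem_evSpan : 1 ∈ evSpan L k A B := by
  convert ev_mem (L := L) (one : Term L k) using 1
  funext x
  rcases x with x | x <;> simp [ev, tpSum, tp, eval]

theorem mul_mem_evSpan {f g : (Fin k → A) ⊕ (Fin k → B) → ℝ} (hf : f ∈ evSpan L k A B)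
    (hg : g ∈ evSpan L k A B) : f * g ∈ evSpan L k A B := by
  have h : evSpan L k A B * evSpan L k A B ≤ evSpan L k A B := by
    rw [evSpan, Submodule.span_mul_span]
    refine Submodule.span_mono ?_
    rintro _ ⟨_, ⟨t, rfl⟩, _, ⟨t', rfl⟩, rfl⟩
    refine ⟨t.mul t', ?_⟩
    funext x
    rcases x with x | x <;> simp [ev, tpSum, tp, eval]
  exact h (Submodule.mul_mem_mul hf hg)

theorem eq_of_tpSum_eq {f : (Fin k → A) ⊕ (Fin k → B) → ℝ} (hf : f ∈ evSpan L k A B)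
    {x y : (Fin k → A) ⊕ (Fin k → B)} (h : tpSum (L := L) A B x = tpSum A B y) : f x = f y := by
  induction hf using Submodule.span_induction with
  | mem f hf =>
    obtain ⟨t, rfl⟩ := hf
    simp only [ev, h]
  | zero => rfl
  | add f g _ _ ihf ihg => simp [ihf, ihg]
  | smul c f _ ih => simp [ih]

theorem sum_eq_of_mem_evSpan
    (H : ∀ t : Term L k, ∑ x : Fin k → A, t.eval A x = ∑ x : Fin k → B, t.eval B x)
    {f : (Fin k → A) ⊕ (Fin k → B) → ℝ} (hf : f ∈ evSpan L k A B) :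
    ∑ x, f (.inl x) = ∑ x, f (.inr x) := by
  induction hf using Submodule.span_induction with
  | mem f hf =>
    obtain ⟨t, rfl⟩ := hf
    simpa [ev, tpSum, tp] using congrArg (Nat.cast (R := ℝ)) (H t)
  | zero => simp
  | add f g _ _ ihf ihg => simp [Finset.sum_add_distrib, ihf, ihg]
  | smul c f _ ih => simp [← Finset.mul_sum, ih]

open Classical in
-- The generators are handled by `push`. It matters that a single `g` works on both sides.
theorem exists_push {f : (Fin k → A) ⊕ (Fin k → B) → ℝ} (hf : f ∈ evSpan L k A B)
    (i : Fin k → Fin k) : ∃ g ∈ evSpan L k A B,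
      (∀ z, g (.inl z) = ∑ x, if x ∘ i = z then f (.inl x) else 0) ∧
      (∀ z, g (.inr z) = ∑ x, if x ∘ i = z then f (.inr x) else 0) := by
  induction hf using Submodule.span_induction with
  | mem f hf =>
    obtain ⟨t, rfl⟩ := hf
    refine ⟨ev A B (push i t), ev_mem _, fun z => ?_, fun z => ?_⟩ <;>
      simp [ev, tpSum, tp, eval_push]
  | zero => exact ⟨0, Submodule.zero_mem _, by simp, by simp⟩
  | add f g _ _ ihf ihg =>
    obtain ⟨f', hf', hf₁, hf₂⟩ := ihf
    obtain ⟨g', hg', hg₁, hg₂⟩ := ihg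
    refine ⟨f' + g', Submodule.add_mem _ hf' hg', fun z => ?_, fun z => ?_⟩ <;>
      simp [hf₁, hf₂, hg₁, hg₂, ← Finset.sum_add_distrib, ← ite_add_zero]
  | smul c f _ ihf =>
    obtain ⟨f', hf', hf₁, hf₂⟩ := ihf
    refine ⟨c • f', Submodule.smul_mem _ _ hf', fun z => ?_, fun z => ?_⟩ <;>
      simp [hf₁, hf₂, Finset.mul_sum]

open Classical in
-- Lagrange interpolation: for each `y` of another type some term separates it from `x`, and an
-- affine function of that term is 1 on the class of `x` and 0 at `y`. The indicator is the product
-- of these factors.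
theorem indicator_mem (x : (Fin k → A) ⊕ (Fin k → B)) :
    (fun y => if tpSum (L := L) A B y = tpSum A B x then (1 : ℝ) else 0) ∈ evSpan L k A B := by
  have key : ∀ y, ∃ g ∈ evSpan L k A B, (∀ z, tpSum (L := L) A B z = tpSum A B x → g z = 1) ∧
      (tpSum (L := L) A B y ≠ tpSum A B x → g y = 0) := by
    intro y
    by_cases h : tpSum (L := L) A B y = tpSum A B x
    · exact ⟨1, one_mem_evSpan, fun _ _ => rfl, fun h' => (h' h).elim⟩
    · obtain ⟨t, ht⟩ := Function.ne_iff.1 h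
      have hne : ev A B t x - ev A B t y ≠ 0 := by
        rw [sub_ne_zero]
        exact fun e => ht (Nat.cast_injective e).symm
      refine ⟨(ev A B t x - ev A B t y)⁻¹ • (ev A B t - ev A B t y • 1),
        Submodule.smul_mem _ _ (Submodule.sub_mem _ (ev_mem t)
          (Submodule.smul_mem _ _ one_mem_evSpan)), fun z hz => ?_, fun _ => ?_⟩
      · have : ev A B t z = ev A B t x := by simp only [ev, hz]
        simp [this, hne]
      · simp
  choose g hg hg₁ hg₀ using key
  have hprod : ∏ y, g y ∈ evSpan L k A B :=
    Finset.prod_induction _ (· ∈ evSpan L k A B) (fun _ _ => mul_mem_evSpan) one_mem_evSpan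
      fun y _ => hg y
  convert hprod using 1
  funext z
  rw [Finset.prod_apply]
  split_ifs with h
  · exact (Finset.prod_eq_one fun y _ => hg₁ y z h).symm
  · exact (Finset.prod_eq_zero (Finset.mem_univ z) (f := fun y => g y z) (hg₀ z h)).symm

theorem count_eq_of_exists
    (H : ∀ t : Term L k, ∑ x : Fin k → A, t.eval A x = ∑ x : Fin k → B, t.eval B x)
    (x : (Fin k → A) ⊕ (Fin k → B)) :
    count A (tpSum (L := L) A B x) = count B (tpSum (L := L) A B x) :=
  sum_eq_of_mem_evSpan H (indicator_mem x)

/-- The fibre size is the push of an indicator, hence lies in the span and depends only on the type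
of the base point. -/
theorem fibre_congr (x : Fin k → A) (i : Fin k → Fin k) {z z' : Fin k → B}
    (h : tp (L := L) B z = tp B z') : fibre B (tp (L := L) A x) i z = fibre B (tp (L := L) A x) i z' := by
  obtain ⟨g, hg, -, hg₂⟩ := exists_push (indicator_mem (L := L) (B := B) (.inl x)) i
  exact (hg₂ z).symm.trans ((eq_of_tpSum_eq hg (x := .inr z) (y := .inr z') h).trans (hg₂ z'))

theorem tp_comp {x : Fin k → A} {y : Fin k → B} (h : tp (L := L) B y = tp A x) (i : Fin k → Fin k) :
    tp (L := L) B (y ∘ i) = tp A (x ∘ i) :=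
  funext fun t => congrFun h (subst i t)

/-- Reindexing by `i` maps the class of `x` into the class of `x ∘ i`, and all fibres over that
class have the same size. -/
theorem count_eq_mul_fibre (x : Fin k → A) (i : Fin k → Fin k) {z : Fin k → B}
    (h : tp (L := L) B z = tp A (x ∘ i)) :
    count B (tp (L := L) A x) = count B (tp (L := L) B z) * fibre B (tp (L := L) A x) i z := by
  classical
  have h₁ : count B (tp (L := L) A x) = ∑ z, fibre B (tp (L := L) A x) i z := by
    simp only [fibre]
    rw [Finset.sum_comm]
    simp [count]
  rw [h₁, count, Finset.sum_mul]
  refine Finset.sum_congr rfl fun z' _ => ?_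
  split_ifs with h'
  · rw [one_mul, fibre_congr x i h']
  · rw [zero_mul]
    refine Finset.sum_eq_zero fun y _ => ?_
    split_ifs with e hy
    · subst e
      exact (h' ((tp_comp hy i).trans h.symm)).elim
    · rfl
    · rfl

theorem count_pos (x : Fin k → A) : 0 < count A (tp (L := L) A x) := by
  classical
  refine Finset.sum_pos' (fun _ _ => by positivity) ⟨x, Finset.mem_univ _, by simp⟩

theorem fibre_eq_zero {x : Fin k → A} {i : Fin k → Fin k} {z : Fin k → B}
    (h : tp (L := L) B z ≠ tp A (x ∘ i)) : fibre B (tp (L := L) A x) i z = 0 := by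
  classical
  refine Finset.sum_eq_zero fun y _ => ?_
  split_ifs with e hy
  · subst e
    exact (h (tp_comp hy i)).elim
  · rfl
  · rfl

open Classical in
/-- The uniform coupling of the tuples of the same type. -/
noncomputable def coupling (L : FirstOrder.Language.{u, v}) {k : ℕ} {A : Type a} [L.Structure A]
    [Fintype A] {B : Type b} [L.Structure B] [Fintype B] (y : Fin k → B) (x : Fin k → A) : ℝ :=
  if tp (L := L) B y = tp A x then (count A (tp (L := L) A x))⁻¹ else 0

theorem coupling_swap
    (H : ∀ t : Term L k, ∑ x : Fin k → A, t.eval A x = ∑ x : Fin k → B, t.eval B x)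
    (y : Fin k → B) (x : Fin k → A) : coupling L y x = coupling L x y := by
  rw [coupling, coupling]
  by_cases h : tp (L := L) B y = tp A x
  · rw [if_pos h, if_pos h.symm, h]
    exact congrArg _ (count_eq_of_exists H (.inl x))
  · rw [if_neg h, if_neg (Ne.symm h)]

theorem coupling_sum_left
    (H : ∀ t : Term L k, ∑ x : Fin k → A, t.eval A x = ∑ x : Fin k → B, t.eval B x)
    (x : Fin k → A) : ∑ y : Fin k → B, coupling L y x = 1 := by
  classical
  have : ∀ y : Fin k → B, coupling L y x =
      (if tp (L := L) B y = tp A x then 1 else 0) * (count A (tp (L := L) A x))⁻¹ := by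
    intro y
    simp [coupling]
  rw [Finset.sum_congr rfl fun y _ => this y, ← Finset.sum_mul]
  change count B (tp A x) * _ = 1
  rw [← show count A (tp A x) = count B (tp (L := L) A x) from count_eq_of_exists H (.inl x)]
  exact mul_inv_cancel₀ (count_pos x).ne'

open Classical in
-- With |class of x| = |class of x ∘ i| · |fibre|, the left side |fibre| / |class of x| is the
-- reciprocal of the size of the class of `x ∘ i`.
theorem coupling_push_left
    (H : ∀ t : Term L k, ∑ x : Fin k → A, t.eval A x = ∑ x : Fin k → B, t.eval B x)
    (i : Fin k → Fin k) (z : Fin k → B) (x : Fin k → A) :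
    (∑ y, if y ∘ i = z then coupling L y x else 0) = coupling L z (x ∘ i) := by
  have : ∀ y : Fin k → B, (if y ∘ i = z then coupling L y x else 0) =
      (if y ∘ i = z then (if tp (L := L) B y = tp A x then 1 else 0) else 0) *
        (count A (tp (L := L) A x))⁻¹ := by
    intro y
    simp [coupling]
  rw [Finset.sum_congr rfl fun y _ => this y, ← Finset.sum_mul]
  change fibre B (tp A x) i z * _ = _
  rw [coupling]
  split_ifs with h
  · have h₁ : count A (tp (L := L) A x) = count B (tp A x) := count_eq_of_exists H (.inl x)
    have h₂ : count A (tp (L := L) A (x ∘ i)) = count B (tp A (x ∘ i)) :=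
      count_eq_of_exists H (.inl (x ∘ i))
    have h₃ := count_eq_mul_fibre x i h
    have h₄ : count B (tp (L := L) B z) ≠ 0 := (count_pos z).ne'
    have h₅ : count A (tp (L := L) A x) ≠ 0 := (count_pos x).ne'
    rw [h₂, ← h, h₁]
    rw [h₁, h₃] at h₅
    rw [h₃]
    -- The fibre is nonempty, so it can be cancelled.
    have := right_ne_zero_of_mul h₅
    field_simp
  · rw [fibre_eq_zero h, zero_mul]

/-- If all terms have the same sums over `A` and over `B`, then there is a coupling. -/
theorem isCoupling
    (H : ∀ t : Term L k, ∑ x : Fin k → A, t.eval A x = ∑ x : Fin k → B, t.eval B x) :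
    IsCoupling L (coupling L : (Fin k → B) → (Fin k → A) → ℝ) := by
  classical
  have htp : ∀ (y : Fin k → B) (x : Fin k → A), coupling L y x ≠ 0 →
      tp (L := L) B y = tp A x := by
    intro y x h
    by_contra h'
    exact h (if_neg h')
  have H' := fun t => (H t).symm
  refine ⟨fun y x => ?_, fun y x h s t => ?_, fun y x h R s => ?_, coupling_push_left H,
    fun i y z => ?_, coupling_sum_left H, fun y => ?_⟩
  · rw [coupling]
    split_ifs
    · exact (inv_pos.2 (count_pos x)).le
    · exact le_rfl
  · have := congrFun (htp y x h) (.eq s t)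
    simp only [tp, eval] at this
    by_cases h₁ : y s = y t <;> by_cases h₂ : x s = x t <;> simp_all
  · have := congrFun (htp y x h) (.rel R s)
    simp only [tp, eval] at this
    by_cases h₁ : Structure.RelMap R.2 (y ∘ s) <;> by_cases h₂ : Structure.RelMap R.2 (x ∘ s) <;>
      simp_all
  · simp only [coupling_swap H]
    exact coupling_push_left H' i z y
  · simp only [coupling_swap H]
    exact coupling_sum_left H' y

end Term

end RelWL

/-! ### Intertwining equations in terms of entries of constraints -/

namespace RelWL

open FirstOrder FirstOrder.Language

namespace Constraint

variable {L : FirstOrder.Language.{u, v}} {A : Type a} [L.Structure A]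

/-- The `i`-th entry of the tuple of a constraint, if there is one. -/
def entry (c : Constraint L A) (i : ℕ) : Option A :=
  if h : i < c.sym.1 then some (c.tup ⟨i, h⟩) else none

theorem entry_val (c : Constraint L A) (i : Fin c.sym.1) : c.entry i = some (c.tup i) := by
  simp [entry]

theorem lt_of_entry_eq_some {c : Constraint L A} {i : ℕ} {x : A} (h : c.entry i = some x) :
    i < c.sym.1 := by
  by_contra h'
  simp [entry, h'] at h

theorem label_eq_iff (c : Constraint L A) (x : A) (R : Sym L) (S : Finset (Fin R.1)) :
    label x c = ⟨R, S⟩ ↔ c.sym = R ∧ ∀ i : Fin R.1, i ∈ S ↔ c.entry i = some x := by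
  obtain ⟨R', t, h⟩ := c
  constructor
  · intro e
    rw [label, Sigma.mk.injEq] at e
    obtain ⟨rfl, e⟩ := e
    refine ⟨rfl, fun i => ?_⟩
    rw [← eq_of_heq e]
    simp [entry]
  · rintro ⟨rfl, e⟩
    rw [label, Sigma.mk.injEq]
    refine ⟨rfl, heq_of_eq ?_⟩
    ext i
    rw [e]
    simp [entry]

end Constraint

variable {L : FirstOrder.Language.{u, v}} {A : Type a} {B : Type b} [L.Structure A] [L.Structure B]

open Classical in
-- Each pair of an element and a constraint has exactly one label, so at most one summand is
-- nonzero.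
theorem sum_incidence_mem (A : Type a) [L.Structure A] (R : Sym L) (i : Fin R.1) (x : A)
    (c : Constraint L A) :
    ∑ S ∈ Finset.univ.filter (i ∈ ·), incidence A ⟨R, S⟩ x c =
      if c.sym = R ∧ c.entry i = some x then 1 else 0 := by
  simp only [incidence, Constraint.label_eq_iff]
  split_ifs with h
  · rw [Finset.sum_eq_single (Finset.univ.filter fun j : Fin R.1 => c.entry j = some x)]
    · simp [h.1]
    · intro S _ hS
      exact if_neg fun H => hS (by ext j; simp [H.2])
    · simp [h.2]
  · refine Finset.sum_eq_zero fun S hS => if_neg fun H => h ⟨H.1, ?_⟩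
    rw [Finset.mem_filter] at hS
    exact (H.2 i).1 hS.2

open Classical in
theorem sum_incidence (A : Type a) [L.Structure A] (R : Sym L) (x : A) (c : Constraint L A) :
    ∑ S, incidence A ⟨R, S⟩ x c = if c.sym = R then 1 else 0 := by
  simp only [incidence, Constraint.label_eq_iff]
  split_ifs with h
  · rw [Finset.sum_eq_single (Finset.univ.filter fun j : Fin R.1 => c.entry j = some x)]
    · simp [h]
    · intro S _ hS
      exact if_neg fun H => hS (by ext j; simp [H.2])
    · simp
  · exact Finset.sum_eq_zero fun S hS => if_neg fun H => h H.1

variable [Finite (Sym L)] [Fintype A] [Fintype B] {Z : Matrix B A ℝ}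
  {Y : Matrix (Constraint L B) (Constraint L A) ℝ}

open Classical in
/-- The equation between an entry of `Z` and a sum of entries of `Y` that is equivalent to the
intertwining property. -/
theorem mul_incidence_eq_of_nonempty
    (hsym : ∀ c' c, Y c' c ≠ 0 →
      c'.sym = c.sym ∧ ∀ i j, c'.entry i = c'.entry j ↔ c.entry i = c.entry j)
    (hP : ∀ c z' i x, c.entry i = some x →
      (∑ c', if c'.entry i = some z' then Y c' c else 0) = Z z' x)
    (R : Sym L) (S : Finset (Fin R.1)) (hS : S.Nonempty) :
    Z * incidence A ⟨R, S⟩ = incidence B ⟨R, S⟩ * Y := by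
  obtain ⟨i, hi⟩ := hS
  ext z' c
  simp only [Matrix.mul_apply, incidence, Constraint.label_eq_iff]
  by_cases hR : c.sym = R
  · subst hR
    -- Since `i ∈ S`, the label condition splits into a condition on `c` alone and the choice of `z`
    -- as the `i`-th entry; `hr` does the same for `c'`, whose equality pattern is that of `c`.
    have hl : ∀ z, (c.sym = c.sym ∧ ∀ j : Fin c.sym.1, j ∈ S ↔ c.entry j = some z) ↔
        (∀ j : Fin c.sym.1, j ∈ S ↔ c.entry j = c.entry i) ∧ z = c.tup i := by
      intro z
      constructor
      · rintro ⟨-, h⟩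
        have := (h i).1 hi
        refine ⟨fun j => by rw [h j, this], ?_⟩
        rw [c.entry_val, Option.some_inj] at this
        exact this.symm
      · rintro ⟨h, rfl⟩
        exact ⟨rfl, fun j => by rw [h j, c.entry_val i]⟩
    have hr : ∀ c', (if c'.sym = c.sym ∧ ∀ j : Fin c.sym.1, j ∈ S ↔ c'.entry j = some z'
        then (1 : ℝ) else 0) * Y c' c =
        if ∀ j : Fin c.sym.1, j ∈ S ↔ c.entry j = c.entry i then
          (if c'.entry i = some z' then Y c' c else 0) else 0 := by
      intro c'
      by_cases h0 : Y c' c = 0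
      · simp [h0]
      · obtain ⟨h₁, h₂⟩ := hsym c' c h0
        have : (c'.sym = c.sym ∧ ∀ j : Fin c.sym.1, j ∈ S ↔ c'.entry j = some z') ↔
            (∀ j : Fin c.sym.1, j ∈ S ↔ c.entry j = c.entry i) ∧ c'.entry i = some z' := by
          constructor
          · rintro ⟨-, h⟩
            have := (h i).1 hi
            exact ⟨fun j => by rw [h j, ← this, h₂], this⟩
          · rintro ⟨h, h'⟩
            exact ⟨h₁, fun j => by rw [h j, ← h₂, h']⟩
        rw [if_congr this rfl rfl, ite_and]
        split_ifs <;> simp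
    rw [Finset.sum_congr rfl fun c' _ => hr c']
    rw [Finset.sum_congr rfl fun z _ => congrArg (Z z' z * ·) (if_congr (hl z) rfl rfl)]
    by_cases h : ∀ j : Fin c.sym.1, j ∈ S ↔ c.entry j = c.entry i
    · simp only [if_pos h, hP c z' i _ (c.entry_val i), and_iff_right h]
      simp
    · simp only [if_neg h, if_neg (fun H => h (And.left H)), mul_zero, Finset.sum_const_zero]
  · rw [Finset.sum_eq_zero, Finset.sum_eq_zero]
    · intro c' _
      by_cases h0 : Y c' c = 0
      · simp [h0]
      · rw [if_neg, zero_mul]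
        exact fun h => hR ((hsym c' c h0).1.symm.trans h.1)
    · intro z _
      simp [hR]

/-- An empty `S` has no position to anchor at. The sum over all `S` depends only on the symbol and
is intertwined because of the sums 1 of `Z` and `Y`; subtracting the nonempty `S` leaves the empty
one. -/
theorem mul_incidence_eq (hZ : ∀ z', ∑ z, Z z' z = 1) (hY : ∀ c, ∑ c', Y c' c = 1)
    (hsym : ∀ c' c, Y c' c ≠ 0 →
      c'.sym = c.sym ∧ ∀ i j, c'.entry i = c'.entry j ↔ c.entry i = c.entry j)
    (hP : open Classical in ∀ c z' i x, c.entry i = some x →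
      (∑ c', if c'.entry i = some z' then Y c' c else 0) = Z z' x)
    (l : Label L) : Z * incidence A l = incidence B l * Y := by
  classical
  obtain ⟨R, S⟩ := l
  rcases S.eq_empty_or_nonempty with rfl | hS
  · have htot : Z * ∑ S, incidence A ⟨R, S⟩ = (∑ S, incidence B ⟨R, S⟩) * Y := by
      ext z' c
      simp only [Matrix.mul_apply, Matrix.sum_apply, sum_incidence]
      have : ∀ c', (if c'.sym = R then (1 : ℝ) else 0) * Y c' c = if c.sym = R then Y c' c else 0 := by
        intro c'
        by_cases h0 : Y c' c = 0
        · simp [h0]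
        · rw [(hsym c' c h0).1]
          simp
      rw [Finset.sum_congr rfl fun c' _ => this c', ← Finset.sum_mul, hZ]
      split_ifs
      · simp [hY]
      · simp
    rw [← Finset.add_sum_erase _ _ (Finset.mem_univ ∅), ← Finset.add_sum_erase _ _
      (Finset.mem_univ ∅), Matrix.mul_add, Matrix.add_mul, Matrix.mul_sum, Matrix.sum_mul] at htot
    rwa [Finset.sum_congr rfl fun S hS => mul_incidence_eq_of_nonempty hsym hP R S
      (Finset.nonempty_iff_ne_empty.2 (Finset.ne_of_mem_erase hS)), add_left_inj] at htot
  · exact mul_incidence_eq_of_nonempty hsym hP R S hS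

open Classical in
-- The intertwining equations are added over all `S` that contain `i`.
theorem sum_entry_eq (h : ∀ l : Label L, Z * incidence A l = incidence B l * Y)
    (c : Constraint L A) (z' : B) (i : ℕ) (x : A) (hx : c.entry i = some x) :
    (∑ c', if c'.sym = c.sym ∧ c'.entry i = some z' then Y c' c else 0) = Z z' x := by
  have hi := Constraint.lt_of_entry_eq_some hx
  have key : Z * ∑ S ∈ Finset.univ.filter ((⟨i, hi⟩ : Fin c.sym.1) ∈ ·), incidence A ⟨c.sym, S⟩ =
      (∑ S ∈ Finset.univ.filter ((⟨i, hi⟩ : Fin c.sym.1) ∈ ·), incidence B ⟨c.sym, S⟩) * Y := by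
    rw [Matrix.mul_sum, Matrix.sum_mul]
    exact Finset.sum_congr rfl fun S _ => h _
  have := congrFun (congrFun key z') c
  simp only [Matrix.mul_apply, Matrix.sum_apply, sum_incidence_mem] at this
  simpa [hx] using this.symm

end RelWL

/-! ### From a coupling to a fractional isomorphism -/

namespace RelWL

open FirstOrder FirstOrder.Language

/-- A surjection `Fin k → Fin n`, for `1 ≤ n ≤ k`. -/
def padIdx {n : ℕ} (k : ℕ) (hn : 1 ≤ n) (s : Fin k) : Fin n :=
  if h : s.1 < n then ⟨s, h⟩ else ⟨0, hn⟩

theorem padIdx_castLE {n k : ℕ} (hn : 1 ≤ n) (h : n ≤ k) (s : Fin n) :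
    padIdx k hn (Fin.castLE h s) = s := by
  simp [padIdx]

variable {L : FirstOrder.Language.{u, v}} {k : ℕ} {A : Type a} {B : Type b} [L.Structure A]
  [L.Structure B]

namespace Star

/-- The sort of an element of `A^{*k}`: the length of a tuple, or the symbol of a constraint. -/
def sort : Star L k A → Set.Icc 1 k ⊕ Sym L
  | .tuple j _ => .inl j
  | .constr c => .inr c.sym

/-- The underlying tuple of an element of `A^{*k}`, padded to length `k`. -/
def pad (hpos : ∀ R : Sym L, 1 ≤ R.1) : Star L k A → Fin k → A
  | .tuple j x => x ∘ padIdx k j.2.1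
  | .constr c => c.tup ∘ padIdx k (hpos c.sym)

variable {hpos : ∀ R : Sym L, 1 ≤ R.1}

theorem comp_padIdx_injective {n : ℕ} (hn : 1 ≤ n) (h : n ≤ k) {x y : Fin n → A}
    (e : x ∘ padIdx k hn = y ∘ padIdx k hn) : x = y := by
  funext s
  have := congrFun e (Fin.castLE h s)
  simpa [padIdx_castLE] using this

theorem eq_of_sort_eq {z z' : Star L k A} (h : z.sort = z'.sort)
    (h' : z.pad hpos = z'.pad hpos) (hle : ∀ R : Sym L, R.1 ≤ k) : z = z' := by
  rcases z with ⟨j, x⟩ | ⟨R, x, hx⟩ <;> rcases z' with ⟨j', x'⟩ | ⟨R', x', hx'⟩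
  · cases h
    rw [comp_padIdx_injective j.2.1 j.2.2 h']
  · cases h
  · cases h
  · simp only [sort, Sum.inr.injEq] at h
    subst h
    simp only [constr.injEq, Constraint.mk.injEq, heq_eq_eq, true_and]
    exact comp_padIdx_injective (hpos R) (hle R) h'

theorem exists_tuple {z : Star L k A} {j : Set.Icc 1 k} (h : z.sort = .inl j) :
    ∃ x : Fin j → A, z = .tuple j x := by
  rcases z with ⟨j', x⟩ | c
  · cases h
    exact ⟨x, rfl⟩
  · cases h

theorem exists_constr {z : Star L k A} {R : Sym L} (h : z.sort = .inr R) :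
    ∃ (x : Fin R.1 → A) (hx : Structure.RelMap R.2 x), z = .constr ⟨R, x, hx⟩ := by
  rcases z with ⟨j', x⟩ | ⟨R', x, hx⟩
  · cases h
  · simp only [sort, Sum.inr.injEq] at h
    subst h
    exact ⟨x, hx, rfl⟩

end Star

theorem StarRel.arity_pos {n : ℕ} (R : StarRel L k n) : 0 < n := by
  cases R <;> norm_num

/-- The sorts of the entries of a constraint of `A^{*k}`. -/
def StarRel.sort : ∀ {n : ℕ}, StarRel L k n → Fin n → Set.Icc 1 k ⊕ Sym L
  | _, .tupleEq j _, _ => .inl j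
  | _, .tupleProj j j' _, t => if t = 0 then .inl j else .inl j'
  | _, .relEq R _, _ => .inr R
  | _, .relProj R j _, t => if t = 0 then .inr R else .inl j

/-- The index maps from the first entry of a constraint of `A^{*k}` to the other entries. -/
def StarRel.map (hle : ∀ R : Sym L, R.1 ≤ k) :
    ∀ {n : ℕ}, StarRel L k n → Fin n → Fin k → Fin k
  | _, .tupleEq _ _, _ => id
  | _, .tupleProj j j' i, t =>
    if t = 0 then id else Fin.castLE j.2.2 ∘ i ∘ padIdx k j'.2.1
  | _, .relEq _ _, _ => id
  | _, .relProj R j i, t => if t = 0 then id else Fin.castLE (hle R) ∘ i ∘ padIdx k j.2.1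

/-- The first entry of a constraint of `A^{*k}`. -/
def starHead (c : Constraint (starLanguage L k) (Star L k A)) : Star L k A :=
  c.tup ⟨0, StarRel.arity_pos c.sym.2⟩

/-- Symbol and first entry determine the whole constraint. After padding, passing to another entry
is a reindexing of k-tuples, which is what couplings respect. -/
theorem starRel_entry (hpos : ∀ R : Sym L, 1 ≤ R.1) (hle : ∀ R : Sym L, R.1 ≤ k)
    (c : Constraint (starLanguage L k) (Star L k A)) (t : Fin c.sym.1) :
    (c.tup t).sort = StarRel.sort c.sym.2 t ∧
      (c.tup t).pad hpos = (starHead c).pad hpos ∘ StarRel.map hle c.sym.2 t := by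
  obtain ⟨⟨_, R⟩, y, h⟩ := c
  cases R with
  | tupleEq j S =>
    obtain ⟨x, h0, -⟩ := h
    obtain rfl := Subsingleton.elim (0 : Fin 1) t
    exact ⟨congrArg Star.sort h0, rfl⟩
  | relEq R S =>
    obtain ⟨x, hx, h0, -⟩ := h
    obtain rfl := Subsingleton.elim (0 : Fin 1) t
    exact ⟨congrArg Star.sort h0, rfl⟩
  | tupleProj j j' i =>
    obtain ⟨x, h0, h1⟩ := h
    match t with
    | 0 => exact ⟨congrArg Star.sort h0, rfl⟩
    | 1 =>
      refine ⟨congrArg Star.sort h1, ?_⟩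
      change (y 1).pad hpos = (y 0).pad hpos ∘ (Fin.castLE j.2.2 ∘ i ∘ padIdx k j'.2.1)
      rw [h0, h1]
      funext s
      simp [Star.pad, padIdx_castLE]
  | relProj R j i =>
    obtain ⟨x, hx, h0, h1⟩ := h
    match t with
    | 0 => exact ⟨congrArg Star.sort h0, rfl⟩
    | 1 =>
      refine ⟨congrArg Star.sort h1, ?_⟩
      change (y 1).pad hpos = (y 0).pad hpos ∘ (Fin.castLE (hle R) ∘ i ∘ padIdx k j.2.1)
      rw [h0, h1]
      funext s
      simp [Star.pad, padIdx_castLE]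

theorem starConstraint_ext (hpos : ∀ R : Sym L, 1 ≤ R.1) (hle : ∀ R : Sym L, R.1 ≤ k)
    {c c' : Constraint (starLanguage L k) (Star L k A)} (h : c.sym = c'.sym)
    (h' : (starHead c).pad hpos = (starHead c').pad hpos) : c = c' := by
  have e := starRel_entry hpos hle c
  have e' := starRel_entry hpos hle c'
  obtain ⟨S, y, hy⟩ := c
  obtain ⟨S', y', hy'⟩ := c'
  obtain rfl : S = S' := h
  have : y = y' := by
    funext t
    refine Star.eq_of_sort_eq (hpos := hpos) ((e t).1.trans (e' t).1.symm) ?_ hle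
    rw [(e t).2, (e' t).2, h']
  subst this
  rfl

/-- Entries coincide iff their sorts do, which the symbol decides, and their padded tuples do, which
the equality pattern of the head decides. -/
theorem starEntry_eq_iff (hpos : ∀ R : Sym L, 1 ≤ R.1) (hle : ∀ R : Sym L, R.1 ≤ k)
    {c : Constraint (starLanguage L k) (Star L k A)} {c' : Constraint (starLanguage L k) (Star L k B)}
    (h : c'.sym = c.sym)
    (h' : ∀ s t, (starHead c').pad hpos s = (starHead c').pad hpos t ↔
      (starHead c).pad hpos s = (starHead c).pad hpos t) (i j : ℕ) :
    c'.entry i = c'.entry j ↔ c.entry i = c.entry j := by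
  have e := starRel_entry hpos hle c
  have e' := starRel_entry hpos hle c'
  obtain ⟨S, y, hy⟩ := c
  obtain ⟨S', y', hy'⟩ := c'
  obtain rfl : S' = S := h
  have key : ∀ i j : Fin S'.1, y' i = y' j ↔ y i = y j := by
    intro i j
    have hy : y i = y j ↔ (y i).sort = (y j).sort ∧ (y i).pad hpos = (y j).pad hpos :=
      ⟨fun h => by simp [h], fun h => Star.eq_of_sort_eq h.1 h.2 hle⟩
    have hy' : y' i = y' j ↔ (y' i).sort = (y' j).sort ∧ (y' i).pad hpos = (y' j).pad hpos :=
      ⟨fun h => by simp [h], fun h => Star.eq_of_sort_eq h.1 h.2 hle⟩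
    rw [hy, hy', (e i).1, (e j).1, (e' i).1, (e' j).1, (e i).2, (e j).2, (e' i).2, (e' j).2]
    refine and_congr Iff.rfl ?_
    simp only [funext_iff, Function.comp_apply]
    exact forall_congr' fun s => h' _ _
  by_cases hi : i < S'.1 <;> by_cases hj : j < S'.1 <;> simp [Constraint.entry, hi, hj, key]

variable {X : (Fin k → B) → (Fin k → A) → ℝ}

open Classical in
/-- The matrix on `A^{*k}` and `B^{*k}` that is defined by a coupling. -/
noncomputable def starMatrix (hpos : ∀ R : Sym L, 1 ≤ R.1) (X : (Fin k → B) → (Fin k → A) → ℝ) :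
    Matrix (Star L k B) (Star L k A) ℝ :=
  fun z' z => if z'.sort = z.sort then X (z'.pad hpos) (z.pad hpos) else 0

open Classical in
/-- The matrix on the constraints of `A^{*k}` and `B^{*k}` that is defined by a coupling. -/
noncomputable def starConstraintMatrix (hpos : ∀ R : Sym L, 1 ≤ R.1)
    (X : (Fin k → B) → (Fin k → A) → ℝ) :
    Matrix (Constraint (starLanguage L k) (Star L k B)) (Constraint (starLanguage L k) (Star L k A))
      ℝ :=
  fun c' c => if c'.sym = c.sym then X ((starHead c').pad hpos) ((starHead c).pad hpos) else 0

theorem starMatrix_swap (hpos : ∀ R : Sym L, 1 ≤ R.1) :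
    starMatrix hpos (fun x y => X y x) = (starMatrix hpos X).transpose := by
  classical
  ext z z'
  exact if_congr eq_comm rfl rfl

theorem starConstraintMatrix_swap (hpos : ∀ R : Sym L, 1 ≤ R.1) :
    starConstraintMatrix hpos (fun x y => X y x) = (starConstraintMatrix hpos X).transpose := by
  classical
  ext z z'
  exact if_congr eq_comm rfl rfl

variable [Fintype A] [Fintype B]

/-- A tuple coupled with a padded tuple has the same equality pattern, so it is itself padded; for a
constraint it also satisfies the relation. -/
theorem IsCoupling.exists_star (hX : IsCoupling L X) (hpos : ∀ R : Sym L, 1 ≤ R.1)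
    (hle : ∀ R : Sym L, R.1 ≤ k) (z : Star L k A) (w : Fin k → B) (h : X w (z.pad hpos) ≠ 0) :
    ∃ z' : Star L k B, z'.sort = z.sort ∧ z'.pad hpos = w := by
  rcases z with ⟨j, x⟩ | ⟨R, x, hx⟩
  · refine ⟨.tuple j (w ∘ Fin.castLE j.2.2), rfl, ?_⟩
    funext s
    refine (hX.eq_iff _ _ h _ _).2 ?_
    simp [Star.pad, padIdx_castLE]
  · refine ⟨.constr ⟨R, w ∘ Fin.castLE (hle R), (hX.rel_iff _ _ h R _).2 ?_⟩, rfl, ?_⟩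
    · convert hx using 1
      funext s
      simp [Star.pad, padIdx_castLE]
    · funext s
      refine (hX.eq_iff _ _ h _ _).2 ?_
      simp [Star.pad, padIdx_castLE]

theorem IsCoupling.exists_starConstraint (hX : IsCoupling L X) (hpos : ∀ R : Sym L, 1 ≤ R.1)
    (hle : ∀ R : Sym L, R.1 ≤ k) (c : Constraint (starLanguage L k) (Star L k A)) (w : Fin k → B)
    (h : X w ((starHead c).pad hpos) ≠ 0) :
    ∃ c' : Constraint (starLanguage L k) (Star L k B),
      c'.sym = c.sym ∧ (starHead c').pad hpos = w := by
  obtain ⟨z', hs, hz'⟩ := hX.exists_star hpos hle _ w h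
  have heq := hX.eq_iff _ _ h
  rw [← hz'] at heq
  obtain ⟨⟨_, R⟩, y, hy⟩ := c
  cases R with
  | tupleEq j S =>
    obtain ⟨x, h0, hS⟩ := hy
    change z'.sort = (y 0).sort at hs
    change ∀ s t, z'.pad hpos s = z'.pad hpos t ↔ (y 0).pad hpos s = (y 0).pad hpos t at heq
    rw [h0] at hs heq
    obtain ⟨x', rfl⟩ := Star.exists_tuple hs
    refine ⟨⟨⟨1, StarRel.tupleEq j S⟩, fun _ => .tuple j x', x', rfl, fun i hi i' hi' => ?_⟩,
      rfl, hz'⟩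
    have := (heq (Fin.castLE j.2.2 i) (Fin.castLE j.2.2 i')).2
    simp only [Star.pad, Function.comp_apply, padIdx_castLE] at this
    exact this (hS i hi i' hi')
  | relEq R S =>
    obtain ⟨x, hx, h0, hS⟩ := hy
    change z'.sort = (y 0).sort at hs
    change ∀ s t, z'.pad hpos s = z'.pad hpos t ↔ (y 0).pad hpos s = (y 0).pad hpos t at heq
    rw [h0] at hs heq
    obtain ⟨x', hx', rfl⟩ := Star.exists_constr hs
    refine ⟨⟨⟨1, StarRel.relEq R S⟩, fun _ => .constr ⟨R, x', hx'⟩, x', hx', rfl,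
      fun i hi i' hi' => ?_⟩, rfl, hz'⟩
    have := (heq (Fin.castLE (hle R) i) (Fin.castLE (hle R) i')).2
    simp only [Star.pad, Function.comp_apply, padIdx_castLE] at this
    exact this (hS i hi i' hi')
  | tupleProj j j' i =>
    obtain ⟨x, h0, _⟩ := hy
    change z'.sort = (y 0).sort at hs
    rw [h0] at hs
    obtain ⟨x', rfl⟩ := Star.exists_tuple hs
    exact ⟨⟨⟨2, StarRel.tupleProj j j' i⟩, ![.tuple j x', .tuple j' (x' ∘ i)], x', rfl, rfl⟩,
      rfl, hz'⟩
  | relProj R j i =>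
    obtain ⟨x, hx, h0, _⟩ := hy
    change z'.sort = (y 0).sort at hs
    rw [h0] at hs
    obtain ⟨x', hx', rfl⟩ := Star.exists_constr hs
    exact ⟨⟨⟨2, StarRel.relProj R j i⟩, ![.constr ⟨R, x', hx'⟩, .tuple j (x' ∘ i)], x', hx', rfl,
      rfl⟩, rfl, hz'⟩

/-- Used with `κ` the sort or symbol and `p` the padded tuple: sums over elements or constraints of
the star structure become sums over k-tuples. -/
theorem sum_ite_key {E W K : Type*} [Fintype E] [Fintype W] {_ : DecidableEq K} (κ : E → K)
    (p : E → W) (κ₀ : K) (f : W → ℝ) (inj : ∀ e e', κ e = κ e' → p e = p e' → e = e')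
    (surj : ∀ w, f w ≠ 0 → ∃ e, κ e = κ₀ ∧ p e = w) :
    (∑ e, if κ e = κ₀ then f (p e) else 0) = ∑ w, f w := by
  rw [← Finset.sum_filter]
  refine Finset.sum_of_injOn p ?_ (fun _ _ => Finset.mem_coe.2 (Finset.mem_univ _)) ?_
    fun _ _ => rfl
  · intro e he e' he' h
    simp only [Finset.coe_filter, Finset.mem_univ, true_and, Set.mem_ofPred_eq] at he he'
    exact inj e e' (he.trans he'.symm) h
  · intro w _ hw
    by_contra h
    obtain ⟨e, he, rfl⟩ := surj w h
    exact hw ⟨e, by simpa using he, rfl⟩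

variable [Finite (Sym L)]

theorem IsCoupling.sum_starMatrix (hX : IsCoupling L X) (hpos : ∀ R : Sym L, 1 ≤ R.1)
    (hle : ∀ R : Sym L, R.1 ≤ k) (z : Star L k A) : ∑ z', starMatrix hpos X z' z = 1 := by
  classical
  refine (sum_ite_key Star.sort (Star.pad hpos) z.sort (X · (z.pad hpos))
    (fun z z' h h' => Star.eq_of_sort_eq h h' hle) ?_).trans (hX.sum_left _)
  exact fun w hw => hX.exists_star hpos hle z w hw

theorem IsCoupling.sum_starConstraintMatrix (hX : IsCoupling L X) (hpos : ∀ R : Sym L, 1 ≤ R.1)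
    (hle : ∀ R : Sym L, R.1 ≤ k) (c : Constraint (starLanguage L k) (Star L k A)) :
    ∑ c', starConstraintMatrix hpos X c' c = 1 := by
  classical
  refine (sum_ite_key Constraint.sym (fun c => (starHead c).pad hpos) c.sym
    (X · ((starHead c).pad hpos))
    (fun z z' h h' => starConstraint_ext hpos hle h h') ?_).trans (hX.sum_left _)
  exact fun w hw => hX.exists_starConstraint hpos hle c w hw

theorem IsCoupling.starMatrix_mul (hX : IsCoupling L X) (hpos : ∀ R : Sym L, 1 ≤ R.1)
    (hle : ∀ R : Sym L, R.1 ≤ k) (l : Label (starLanguage L k)) :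
    starMatrix hpos X * incidence (Star L k A) l =
      incidence (Star L k B) l * starConstraintMatrix hpos X := by
  classical
  refine mul_incidence_eq (fun z' => ?_) (hX.sum_starConstraintMatrix hpos hle) ?_ ?_ l
  · have := hX.swap.sum_starMatrix hpos hle z'
    simpa only [starMatrix_swap, Matrix.transpose_apply] using this
  · intro c' c h
    rw [starConstraintMatrix, ite_ne_right_iff] at h
    exact ⟨h.1, starEntry_eq_iff hpos hle h.1 (hX.eq_iff _ _ h.2)⟩
  · intro c z' i z hz
    have hi := Constraint.lt_of_entry_eq_some hz
    obtain rfl : c.tup ⟨i, hi⟩ = z := by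
      have := c.entry_val ⟨i, hi⟩
      rw [hz, Option.some_inj] at this
      exact this.symm
    set m := StarRel.map hle c.sym.2 ⟨i, hi⟩ with hm
    have hc := starRel_entry hpos hle c ⟨i, hi⟩
    -- For constraints with the symbol of `c`, having `z'` as `i`-th entry is a condition on the
    -- padded head `w`, so the sum takes the shape of `push_left` for the index map `m`.
    let f : (Fin k → B) → ℝ := fun w => if z'.sort = StarRel.sort c.sym.2 ⟨i, hi⟩ then
      (if w ∘ m = z'.pad hpos then X w ((starHead c).pad hpos) else 0) else 0
    have : ∀ c' : Constraint (starLanguage L k) (Star L k B),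
        (if c'.entry i = some z' then starConstraintMatrix hpos X c' c else 0) =
        if c'.sym = c.sym then f ((starHead c').pad hpos) else 0 := by
      intro c'
      by_cases hs : c'.sym = c.sym
      · have e : c'.entry i = some z' ↔ z'.sort = StarRel.sort c.sym.2 ⟨i, hi⟩ ∧
            (starHead c').pad hpos ∘ m = z'.pad hpos := by
          have hc' := starRel_entry hpos hle c'
          clear hc hz
          obtain ⟨S, y, hy⟩ := c
          obtain ⟨S', y', hy'⟩ := c'
          obtain rfl : S' = S := hs
          have hi' : i < S'.1 := hi
          rw [hm, ← (hc' ⟨i, hi⟩).1, ← (hc' ⟨i, hi⟩).2]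
          simp only [Constraint.entry, hi', dif_pos, Option.some_inj]
          exact ⟨fun h => by simp [h], fun h => Star.eq_of_sort_eq h.1.symm h.2 hle⟩
        simp only [starConstraintMatrix, if_pos hs, e, ite_and, f]
      · simp [starConstraintMatrix, hs]
    refine (Finset.sum_congr rfl fun c' _ => this c').trans ((sum_ite_key Constraint.sym
      (fun c => (starHead c).pad hpos) c.sym f
      (fun z z' h h' => starConstraint_ext hpos hle h h') ?_).trans ?_)
    · intro w hw
      simp only [f] at hw
      rw [ite_ne_right_iff, ite_ne_right_iff] at hw
      exact hX.exists_starConstraint hpos hle c w hw.2.2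
    · simp only [f]
      rw [starMatrix, hc.1, hc.2]
      split_ifs
      · exact hX.push_left _ _ _
      · simp

theorem IsCoupling.eqWL (hX : IsCoupling L X) (hpos : ∀ R : Sym L, 1 ≤ R.1)
    (hle : ∀ R : Sym L, R.1 ≤ k) : EqWL L k A B := by
  refine ⟨starMatrix hpos X, starConstraintMatrix hpos X, ⟨fun z' z => ?_, fun z' => ?_,
    hX.sum_starMatrix hpos hle⟩, ⟨fun c' c => ?_, fun c' => ?_,
    hX.sum_starConstraintMatrix hpos hle⟩, fun l => ⟨hX.starMatrix_mul hpos hle l, ?_⟩⟩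
  · rw [starMatrix]
    split_ifs
    exacts [hX.nonneg _ _, le_rfl]
  · simpa only [starMatrix_swap, Matrix.transpose_apply] using hX.swap.sum_starMatrix hpos hle z'
  · rw [starConstraintMatrix]
    split_ifs
    exacts [hX.nonneg _ _, le_rfl]
  · simpa only [starConstraintMatrix_swap, Matrix.transpose_apply] using
      hX.swap.sum_starConstraintMatrix hpos hle c'
  -- The second family of equations is the first one for the swapped coupling.
  · simpa only [starMatrix_swap, starConstraintMatrix_swap] using
      (hX.swap.starMatrix_mul hpos hle l).symm

end RelWL

/-! ### From a fractional isomorphism to a coupling -/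

namespace RelWL

open FirstOrder FirstOrder.Language

variable {L : FirstOrder.Language.{u, v}} {k : ℕ} {A : Type a} {B : Type b} [L.Structure A]
  [L.Structure B]

/-- The constraints of `A^{*k}` with symbol `T_{j,S}`. -/
def tupleEqConstraint (j : Set.Icc 1 k) (S : Finset (Fin j)) (x : Fin j → A)
    (h : ∀ i ∈ S, ∀ i' ∈ S, x i = x i') : Constraint (starLanguage L k) (Star L k A) :=
  ⟨⟨1, StarRel.tupleEq j S⟩, fun _ => .tuple j x, x, rfl, h⟩

/-- The constraints of `A^{*k}` with symbol `T_{j,i}`. -/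
def tupleProjConstraint (j j' : Set.Icc 1 k) (i : Fin j' → Fin j) (x : Fin j → A) :
    Constraint (starLanguage L k) (Star L k A) :=
  ⟨⟨2, StarRel.tupleProj j j' i⟩, ![.tuple j x, .tuple j' fun s => x (i s)], x, rfl, rfl⟩

/-- The constraints of `A^{*k}` with symbol `R_i`. -/
def relProjConstraint (R : Sym L) (j : Set.Icc 1 k) (i : Fin j → Fin R.1) (x : Fin R.1 → A)
    (h : Structure.RelMap R.2 x) : Constraint (starLanguage L k) (Star L k A) :=
  ⟨⟨2, StarRel.relProj R j i⟩, ![.constr ⟨R, x, h⟩, .tuple j fun s => x (i s)], x, h, rfl, rfl⟩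

theorem exists_eq_tupleEqConstraint {j : Set.Icc 1 k} {S : Finset (Fin j)}
    {c : Constraint (starLanguage L k) (Star L k A)} (hc : c.sym = ⟨1, StarRel.tupleEq j S⟩) :
    ∃ x h, c = tupleEqConstraint j S x h := by
  obtain ⟨_, y, hy⟩ := c
  obtain rfl := hc
  obtain ⟨x, h0, h⟩ := id hy
  refine ⟨x, h, ?_⟩
  have : y = fun _ => .tuple j x := by
    funext t
    rw [← h0, Subsingleton.elim t (0 : Fin 1)]
  subst this
  rfl

theorem exists_eq_tupleProjConstraint {j j' : Set.Icc 1 k} {i : Fin j' → Fin j}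
    {c : Constraint (starLanguage L k) (Star L k A)} (hc : c.sym = ⟨2, StarRel.tupleProj j j' i⟩) :
    ∃ x, c = tupleProjConstraint j j' i x := by
  obtain ⟨_, y, hy⟩ := c
  obtain rfl := hc
  obtain ⟨x, h0, h1⟩ := id hy
  refine ⟨x, ?_⟩
  have : y = ![.tuple j x, .tuple j' fun s => x (i s)] := by
    funext t
    match t with
    | 0 => exact h0
    | 1 => exact h1
  subst this
  rfl

theorem exists_eq_relProjConstraint {R : Sym L} {j : Set.Icc 1 k} {i : Fin j → Fin R.1}
    {c : Constraint (starLanguage L k) (Star L k A)} (hc : c.sym = ⟨2, StarRel.relProj R j i⟩) :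
    ∃ x h, c = relProjConstraint R j i x h := by
  obtain ⟨_, y, hy⟩ := c
  obtain rfl := hc
  obtain ⟨x, h, h0, h1⟩ := id hy
  refine ⟨x, h, ?_⟩
  have : y = ![.constr ⟨R, x, h⟩, .tuple j fun s => x (i s)] := by
    funext t
    match t with
    | 0 => exact h0
    | 1 => exact h1
  subst this
  rfl

theorem entry_tupleEqConstraint {j : Set.Icc 1 k} {S : Finset (Fin j)} {x : Fin j → A}
    (h : ∀ i ∈ S, ∀ i' ∈ S, x i = x i') :
    (tupleEqConstraint (L := L) j S x h).entry 0 = some (.tuple j x) := rfl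

theorem entry_zero_tupleProjConstraint {j j' : Set.Icc 1 k} {i : Fin j' → Fin j} (x : Fin j → A) :
    (tupleProjConstraint (L := L) j j' i x).entry 0 = some (.tuple j x) := rfl

theorem entry_one_tupleProjConstraint {j j' : Set.Icc 1 k} {i : Fin j' → Fin j} (x : Fin j → A) :
    (tupleProjConstraint (L := L) j j' i x).entry 1 = some (.tuple j' fun s => x (i s)) := rfl

theorem entry_one_relProjConstraint {R : Sym L} {j : Set.Icc 1 k} {i : Fin j → Fin R.1}
    {x : Fin R.1 → A} (h : Structure.RelMap R.2 x) :
    (relProjConstraint R j i x h).entry 1 = some (.tuple j fun s => x (i s)) := rfl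

section

variable [Finite (Sym L)] [Fintype A] [Fintype B]
  {Z : Matrix (Star L k B) (Star L k A) ℝ}
  {Y : Matrix (Constraint (starLanguage L k) (Star L k B))
    (Constraint (starLanguage L k) (Star L k A)) ℝ}

/-- The nonzero entry of `Z` is a sum over such `c'`. Applied to well-chosen symbols, this yields
every property of the support of `Z`. -/
theorem exists_of_ne_zero
    (h : ∀ l : Label (starLanguage L k), Z * incidence _ l = incidence _ l * Y)
    {c : Constraint (starLanguage L k) (Star L k A)} {i : ℕ} {z : Star L k A} {z' : Star L k B}
    (hz : c.entry i = some z) (hne : Z z' z ≠ 0) : 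
    ∃ c' : Constraint (starLanguage L k) (Star L k B), c'.sym = c.sym ∧ c'.entry i = some z' := by
  classical
  rw [← sum_entry_eq h c z' i z hz] at hne
  obtain ⟨c', -, hc'⟩ := Finset.exists_ne_zero_of_sum_ne_zero hne
  rw [ite_ne_right_iff] at hc'
  exact ⟨c', hc'.1⟩

open Classical in
-- Constraints with symbol T_{j,i} correspond to j-tuples. Position 0 identifies `Y` on them with
-- `Z`; position 1 then gives the equation.
theorem sum_tuple_eq
    (h : ∀ l : Label (starLanguage L k), Z * incidence _ l = incidence _ l * Y)
    (j j' : Set.Icc 1 k) (i : Fin j' → Fin j) (x : Fin j → A) (y' : Fin j' → B) :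
    (∑ y : Fin j → B, if y ∘ i = y' then Z (.tuple j y) (.tuple j x) else 0) =
      Z (.tuple j' y') (.tuple j' (x ∘ i)) := by
  have hsum : ∀ (n : ℕ) (w : Star L k B),
      (∑ c', if c'.sym = (tupleProjConstraint (L := L) j j' i x).sym ∧ c'.entry n = some w then
        Y c' (tupleProjConstraint j j' i x) else 0) =
      ∑ y : Fin j → B, if (tupleProjConstraint j j' i y).entry n = some w then
        Y (tupleProjConstraint j j' i y) (tupleProjConstraint j j' i x) else 0 := by
    intro n w
    symm
    refine Finset.sum_of_injOn (tupleProjConstraint j j' i) ?_ (by simp) ?_ ?_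
    · intro y _ y' _ e
      have := congrArg (Constraint.entry · 0) e
      simp only [entry_zero_tupleProjConstraint, Option.some_inj, Star.tuple.injEq, heq_eq_eq,
        true_and] at this
      exact this
    · intro c' _ hc'
      refine if_neg fun H => hc' ?_
      obtain ⟨y, rfl⟩ := exists_eq_tupleProjConstraint H.1
      exact ⟨y, by simp, rfl⟩
    · intro y _
      exact if_congr (and_iff_right rfl).symm rfl rfl
  have h₀ : ∀ y : Fin j → B, Y (tupleProjConstraint j j' i y) (tupleProjConstraint j j' i x) =
      Z (.tuple j y) (.tuple j x) := by
    intro y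
    rw [← sum_entry_eq h _ (.tuple j y) 0 _ (entry_zero_tupleProjConstraint (i := i) x), hsum]
    simp [entry_zero_tupleProjConstraint]
  have h₁ := sum_entry_eq h _ (.tuple j' y') 1 _ (entry_one_tupleProjConstraint (i := i) x)
  rw [hsum] at h₁
  simp only [h₀, entry_one_tupleProjConstraint, Option.some_inj, Star.tuple.injEq, heq_eq_eq,
    true_and] at h₁
  exact h₁

theorem tuple_eq_of_ne_zero
    (h : ∀ l : Label (starLanguage L k), Z * incidence _ l = incidence _ l * Y)
    {j : Set.Icc 1 k} {y : Fin j → B} {x : Fin j → A} (hne : Z (.tuple j y) (.tuple j x) ≠ 0)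
    {s t : Fin j} (hx : x s = x t) : y s = y t := by
  have hS : ∀ i ∈ ({s, t} : Finset (Fin j)), ∀ i' ∈ ({s, t} : Finset (Fin j)), x i = x i' := by
    simp [hx]
  obtain ⟨c', hc', he⟩ := exists_of_ne_zero h (entry_tupleEqConstraint hS) hne
  obtain ⟨y', hy', rfl⟩ := exists_eq_tupleEqConstraint hc'
  rw [entry_tupleEqConstraint, Option.some_inj] at he
  cases he
  exact hy' s (by simp) t (by simp)

/-- By nonnegativity and `sum_tuple_eq` the support is closed under projection, so the tuples of
length arity(R) are matched too, and R_i with `i = id` detects whether they satisfy the relation. -/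
theorem tuple_rel_of_ne_zero (hZ : ∀ z' z, 0 ≤ Z z' z)
    (h : ∀ l : Label (starLanguage L k), Z * incidence _ l = incidence _ l * Y)
    {j : Set.Icc 1 k} {y : Fin j → B} {x : Fin j → A} (hne : Z (.tuple j y) (.tuple j x) ≠ 0)
    (R : Sym L) (hpos : 1 ≤ R.1) (hle : R.1 ≤ k) (s : Fin R.1 → Fin j)
    (hx : Structure.RelMap R.2 (x ∘ s)) : Structure.RelMap R.2 (y ∘ s) := by
  classical
  have hne' : Z (.tuple ⟨R.1, hpos, hle⟩ (y ∘ s)) (.tuple ⟨R.1, hpos, hle⟩ (x ∘ s)) ≠ 0 := by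
    rw [← sum_tuple_eq h j ⟨R.1, hpos, hle⟩ s x (y ∘ s)]
    refine (Finset.sum_pos' (fun y' _ => ?_) ⟨y, Finset.mem_univ _, ?_⟩).ne'
    · split_ifs
      exacts [hZ _ _, le_rfl]
    · rw [if_pos rfl]
      exact (hZ _ _).lt_of_ne' hne
  obtain ⟨c', hc', he⟩ := exists_of_ne_zero h
    (entry_one_relProjConstraint (j := ⟨R.1, hpos, hle⟩) (i := id) hx) hne'
  obtain ⟨y', hy', rfl⟩ := exists_eq_relProjConstraint hc'
  rw [entry_one_relProjConstraint, Option.some_inj, Star.tuple.injEq] at he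
  have : y' = y ∘ s := eq_of_heq he.2
  exact this ▸ hy'

theorem sum_tuple_eq_one (hZ : ∀ z, ∑ z', Z z' z = 1)
    (h : ∀ l : Label (starLanguage L k), Z * incidence _ l = incidence _ l * Y)
    (j : Set.Icc 1 k) (x : Fin j → A) : ∑ y, Z (.tuple j y) (.tuple j x) = 1 := by
  classical
  rw [← hZ (.tuple j x)]
  refine Finset.sum_of_injOn (Star.tuple j) ?_ (by simp) ?_ fun _ _ => rfl
  · intro y _ y' _ e
    simpa using e
  · intro z' _ hz'
    by_contra hne
    -- T_{j,∅} holds of all j-tuples and of nothing else, so the column is supported on j-tuples.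
    have hS : ∀ i ∈ (∅ : Finset (Fin j)), ∀ i' ∈ (∅ : Finset (Fin j)), x i = x i' := by simp
    obtain ⟨c', hc', he⟩ := exists_of_ne_zero h (entry_tupleEqConstraint hS) hne
    obtain ⟨y', hy', rfl⟩ := exists_eq_tupleEqConstraint hc'
    rw [entry_tupleEqConstraint, Option.some_inj] at he
    exact hz' ⟨y', by simp, he⟩

end

theorem EqWL.exists_isCoupling [Finite (Sym L)] [Fintype A] [Fintype B] (h : EqWL L k A B)
    (hk : 1 ≤ k) (hpos : ∀ R : Sym L, 1 ≤ R.1) (hle : ∀ R : Sym L, R.1 ≤ k) :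
    ∃ X : (Fin k → B) → (Fin k → A) → ℝ, IsCoupling L X := by
  classical
  obtain ⟨Z, Y, hZ, hY, h⟩ := h
  have h₁ : ∀ l, Z * incidence _ l = incidence _ l * Y := fun l => (h l).1
  -- The hypothesis is symmetric under transposition, which supplies every statement with `A` and
  -- `B` exchanged.
  have h₂ : ∀ l, Z.transpose * incidence _ l = incidence _ l * Y.transpose := fun l => (h l).2.symm
  let κ : Set.Icc 1 k := ⟨k, hk, le_rfl⟩
  refine ⟨fun y x => Z (.tuple κ y) (.tuple κ x), ⟨fun y x => hZ.1 _ _, fun y x hne s t => ?_,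
    fun y x hne R s => ?_, fun i z x => ?_, fun i y z => ?_, fun x => ?_, fun y => ?_⟩⟩
  · exact ⟨fun e => tuple_eq_of_ne_zero h₂ (j := κ) hne e,
      fun e => tuple_eq_of_ne_zero h₁ (j := κ) hne e⟩
  · exact ⟨tuple_rel_of_ne_zero (fun _ _ => hZ.1 _ _) h₂ (j := κ) hne R (hpos R) (hle R) s,
      tuple_rel_of_ne_zero hZ.1 h₁ (j := κ) hne R (hpos R) (hle R) s⟩
  · exact sum_tuple_eq h₁ κ κ i x z
  · exact sum_tuple_eq h₂ κ κ i y z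
  · exact sum_tuple_eq_one hZ.2.2 h₁ κ x
  · exact sum_tuple_eq_one (Z := Z.transpose) hZ.2.1 h₂ κ y

end RelWL

/-! ### Summing out one element of a bag -/

namespace RelWL

open FirstOrder FirstOrder.Language

variable {k : ℕ} {A : Type a} {B : Type b} {Q : Type q}

/-- The restrictions of `f` and `g` to the set `s` are related by `X`. -/
def Related (X : (Fin k → B) → (Fin k → A) → ℝ) (s : Finset Q) (f : Q → A) (g : Q → B) : Prop :=
  ∀ e : Fin k → Q, (∀ t, e t ∈ s) → X (g ∘ e) (f ∘ e) ≠ 0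

theorem Related.mono {s t : Finset Q} {f : Q → A} {g : Q → B} (h : Related X t f g) (hst : s ⊆ t) :
    Related X s f g :=
  fun e he => h e fun u => hst (he u)

/-- Superfluous positions repeat `z₀`, so that changing the value at `x` affects the single
coordinate `t`. -/
theorem exists_enumeration {s : Finset Q} (hs : s.card ≤ k) {x z₀ : Q} (hx : x ∈ s) (hz₀ : z₀ ∈ s)
    (hne : z₀ ≠ x) : ∃ (e : Fin k → Q) (t t₀ : Fin k), (∀ u, e u ∈ s) ∧ (∀ z ∈ s, ∃ u, e u = z) ∧
      (∀ u, e u = x ↔ u = t) ∧ e t₀ = z₀ := by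
  obtain ⟨j⟩ : Nonempty (s ↪ Fin k) :=
    Function.Embedding.nonempty_of_card_le (by simpa using hs)
  have hj : ∀ z : s, Function.extend j Subtype.val (fun _ => z₀) (j z) = z :=
    fun z => j.injective.extend_apply _ _ z
  refine ⟨Function.extend j Subtype.val fun _ => z₀, j ⟨x, hx⟩, j ⟨z₀, hz₀⟩, fun u => ?_,
    fun z hz => ⟨j ⟨z, hz⟩, hj _⟩, fun u => ?_, hj _⟩
  · by_cases hu : ∃ z, j z = u
    · obtain ⟨z, rfl⟩ := hu
      rw [hj]
      exact z.2
    · rwa [Function.extend_apply' _ _ _ hu]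
  · by_cases hu : ∃ z, j z = u
    · obtain ⟨z, rfl⟩ := hu
      rw [hj, j.injective.eq_iff, Subtype.ext_iff]
    · rw [Function.extend_apply' _ _ _ hu]
      exact ⟨fun h => (hne h).elim, fun h => (hu ⟨_, h.symm⟩).elim⟩

/-- Exchanging `c` with the value of `f` at `x` is an involution on pairs; afterwards `c` is a dummy
variable, whence the factor |A|. -/
theorem sum_sum_update [Fintype A] [Fintype Q] [DecidableEq Q] (x : Q) (φ ψ : (Q → A) → ℝ)
    (hψ : ∀ f c, ψ (Function.update f x c) = ψ f) :
    ∑ f, (∑ c, φ (Function.update f x c)) * ψ f = Fintype.card A * ∑ f, φ f * ψ f := by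
  calc ∑ f, (∑ c, φ (Function.update f x c)) * ψ f
      = ∑ f, ∑ c, φ (Function.update f x c) * ψ (Function.update f x c) := by
        simp only [hψ, Finset.sum_mul]
    _ = ∑ p : (Q → A) × A, φ (Function.update p.1 x p.2) * ψ (Function.update p.1 x p.2) :=
        (Fintype.sum_prod_type' _).symm
    _ = ∑ p : (Q → A) × A, φ p.1 * ψ p.1 := by
        refine Finset.sum_nbij' (fun p => (Function.update p.1 x p.2, p.1 x))
          (fun p => (Function.update p.1 x p.2, p.1 x)) ?_ ?_ ?_ ?_ ?_ <;> simp
    _ = Fintype.card A * ∑ f, φ f * ψ f := by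
        rw [Fintype.sum_prod_type]
        simp [Finset.mul_sum]

variable {L : FirstOrder.Language.{u, v}} [L.Structure A] [L.Structure B] [Fintype A] [Fintype B]
  {X : (Fin k → B) → (Fin k → A) → ℝ}

theorem IsCoupling.card_eq (hX : IsCoupling L X) (hk : 1 ≤ k) : Fintype.card A = Fintype.card B := by
  classical
  have h : Fintype.card (Fin k → B) = Fintype.card (Fin k → A) :=
    IsDoublyStochastic.card_eq (X := X) ⟨hX.nonneg, hX.sum_right, hX.sum_left⟩
  simp only [Fintype.card_fun, Fintype.card_fin] at h
  exact (Nat.pow_left_injective (by omega) h).symm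

theorem IsCoupling.comp_ne_zero (hX : IsCoupling L X) {y : Fin k → B} {x : Fin k → A}
    (h : X y x ≠ 0) (i : Fin k → Fin k) : X (y ∘ i) (x ∘ i) ≠ 0 := by
  classical
  rw [← hX.push_left]
  refine (Finset.sum_pos' (fun y' _ => ?_) ⟨y, Finset.mem_univ _, ?_⟩).ne'
  · split_ifs
    exacts [hX.nonneg _ _, le_rfl]
  · rw [if_pos rfl]
    exact (hX.nonneg _ _).lt_of_ne' h

theorem IsCoupling.related_of_ne_zero (hX : IsCoupling L X) {s : Finset Q} {f : Q → A} {g : Q → B}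
    {e : Fin k → Q} (he : ∀ z ∈ s, ∃ u, e u = z) (h : X (g ∘ e) (f ∘ e) ≠ 0) : Related X s f g := by
  intro e' he'
  choose i hi using fun t => he _ (he' t)
  obtain rfl : e ∘ i = e' := funext hi
  exact hX.comp_ne_zero h i

variable [DecidableEq Q]

/-- Double counting: the coupling entries form a matrix in `c` and `d` with all row and column sums
`w`, supported where the two weights agree. -/
theorem IsCoupling.sum_update_eq_of_weight (hX : IsCoupling L X) {s : Finset Q} {x : Q}
    {φ : (Q → A) → ℝ} {ψ : (Q → B) → ℝ} (hφ : ∀ f g, Related X s f g → φ f = ψ g) {f : Q → A}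
    {g : Q → B} {e : Fin k → Q} (he : ∀ z ∈ s, ∃ u, e u = z) {w : ℝ} (hw : w ≠ 0)
    (h₁ : ∀ c, ∑ d, X (Function.update g x d ∘ e) (Function.update f x c ∘ e) = w)
    (h₂ : ∀ d, ∑ c, X (Function.update g x d ∘ e) (Function.update f x c ∘ e) = w) :
    ∑ c, φ (Function.update f x c) = ∑ d, ψ (Function.update g x d) := by
  refine mul_left_cancel₀ hw ?_
  rw [Finset.mul_sum, Finset.mul_sum]
  calc ∑ c, w * φ (Function.update f x c)
      = ∑ c, ∑ d, X (Function.update g x d ∘ e) (Function.update f x c ∘ e) *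
          φ (Function.update f x c) := by
        refine Finset.sum_congr rfl fun c _ => ?_
        rw [← Finset.sum_mul, h₁]
    _ = ∑ c, ∑ d, X (Function.update g x d ∘ e) (Function.update f x c ∘ e) *
          ψ (Function.update g x d) := by
        refine Finset.sum_congr rfl fun c _ => Finset.sum_congr rfl fun d _ => ?_
        by_cases h : X (Function.update g x d ∘ e) (Function.update f x c ∘ e) = 0
        · simp [h]
        · rw [hφ _ _ (hX.related_of_ne_zero he h)]
    _ = ∑ d, w * ψ (Function.update g x d) := by
        rw [Finset.sum_comm]
        refine Finset.sum_congr rfl fun d _ => ?_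
        rw [← Finset.sum_mul, h₂]

theorem IsCoupling.sum_update_const (hX : IsCoupling L X) (t : Fin k) (x : Q) (f : Q → A) (g : Q → B)
    (c : A) :
    ∑ d, X (Function.update g x d ∘ fun _ => x) (Function.update f x c ∘ fun _ => x) = 1 := by
  rw [← hX.sum_left (Function.update f x c ∘ fun _ => x)]
  refine Finset.sum_of_injOn (fun d => Function.update g x d ∘ fun _ => x) ?_ (by simp) ?_
    fun _ _ => rfl
  · intro d _ d' _ h
    simpa using congrFun h t
  · intro y _ hy
    by_contra h
    refine hy ⟨y t, by simp, ?_⟩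
    funext s
    simpa using (hX.eq_iff _ _ h t s).2 rfl

/-- This is `push_left` for the map that overwrites position `t` by `t₀`: the fibre consists of the
tuples with arbitrary value at `t`, that is, at `x`. The result does not depend on `c`. -/
theorem IsCoupling.sum_update_of_inj (hX : IsCoupling L X) {x z₀ : Q} (hz₀ : z₀ ≠ x) {e : Fin k → Q}
    {t t₀ : Fin k} (ht : ∀ u, e u = x ↔ u = t) (ht₀ : e t₀ = z₀) (f : Q → A) (g : Q → B) (c : A) :
    ∑ d, X (Function.update g x d ∘ e) (Function.update f x c ∘ e) =
      X (g ∘ e ∘ Function.update id t t₀) (f ∘ e ∘ Function.update id t t₀) := by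
  classical
  have hne : ∀ u, e (Function.update id t t₀ u) ≠ x := by
    intro u
    by_cases hu : u = t
    · subst hu
      simp [ht₀, hz₀]
    · simp [hu, ht]
  have hf : f ∘ e ∘ Function.update id t t₀ =
      (Function.update f x c ∘ e) ∘ Function.update id t t₀ := by
    funext u
    simp [Function.update_of_ne (hne u)]
  rw [hf, ← hX.push_left, ← Finset.sum_filter]
  refine Finset.sum_of_injOn (fun d => Function.update g x d ∘ e) ?_ ?_ ?_ fun _ _ => rfl
  · intro d _ d' _ h
    simpa [(ht t).2 rfl] using congrFun h t
  · intro d _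
    simp only [Finset.coe_filter, Finset.mem_univ, true_and]
    funext u
    simp [Function.update_of_ne (hne u)]
  · intro y hy hy'
    refine (hy' ⟨y t, by simp, ?_⟩).elim
    rw [Finset.mem_filter] at hy
    funext u
    by_cases hu : u = t
    · subst hu
      simp [(ht u).2 rfl]
    · have := congrFun hy.2 u
      simp only [Function.comp_apply, Function.update_of_ne hu, id] at this
      exact (Function.update_of_ne (fun h => hu ((ht u).1 h)) _ _).trans this.symm

/-- The common weight is a coupling entry that does not see `x`, nonzero by `h`. If `x` is alone in
the bag there is nothing to overwrite it with; then constant tuples are used, with weight 1. -/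
theorem IsCoupling.sum_update_eq (hX : IsCoupling L X) {s : Finset Q} (hs : s.card ≤ k) {x : Q}
    (hx : x ∈ s) {φ : (Q → A) → ℝ} {ψ : (Q → B) → ℝ} (hφ : ∀ f g, Related X s f g → φ f = ψ g)
    {f : Q → A} {g : Q → B} (h : Related X (s.erase x) f g) :
    ∑ c, φ (Function.update f x c) = ∑ d, ψ (Function.update g x d) := by
  by_cases hz : ∃ z₀ ∈ s, z₀ ≠ x
  · obtain ⟨z₀, hz₀, hne⟩ := hz
    obtain ⟨e, t, t₀, hes, he, ht, ht₀⟩ := exists_enumeration hs hx hz₀ hne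
    refine hX.sum_update_eq_of_weight hφ he (h (e ∘ Function.update id t t₀) fun u => ?_)
      (hX.sum_update_of_inj hne ht ht₀ f g) (hX.swap.sum_update_of_inj hne ht ht₀ g f)
    refine Finset.mem_erase.2 ⟨?_, hes _⟩
    by_cases hu : u = t
    · subst hu
      simp [ht₀, hne]
    · simp [hu, ht]
  · push Not at hz
    have t : Fin k := ⟨0, (Finset.card_pos.2 ⟨x, hx⟩).trans_le hs⟩
    exact hX.sum_update_eq_of_weight hφ (e := fun _ => x) (fun z hz' => ⟨t, (hz z hz').symm⟩)
      one_ne_zero (hX.sum_update_const t x f g) (hX.swap.sum_update_const t x g f)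

end RelWL

/-! ### Weighted trees and homomorphism counts -/

namespace RelWL

open FirstOrder FirstOrder.Language

variable {k : ℕ} {A : Type a} {B : Type b} {Q : Type q}

/-- Weights on maps `Q → A` and `Q → B`, attached to the nodes of a tree with bags in `Q`. -/
structure IsWeightedTree (X : (Fin k → B) → (Fin k → A) → ℝ) {V : Type} (G : SimpleGraph V)
    (bag : V → Finset Q) (φ : V → (Q → A) → ℝ) (ψ : V → (Q → B) → ℝ) : Prop where
  isTree : G.IsTree
  mem_of_path : ∀ (x : Q) (w₁ w₂ : V) (p : G.Walk w₁ w₂), p.IsPath →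
    x ∈ bag w₁ → x ∈ bag w₂ → ∀ w ∈ p.support, x ∈ bag w
  card_le : ∀ w, (bag w).card ≤ k
  congr_left : ∀ w f f', (∀ x ∈ bag w, f x = f' x) → φ w f = φ w f'
  congr_right : ∀ w g g', (∀ x ∈ bag w, g x = g' x) → ψ w g = ψ w g'
  related : ∀ w f g, Related X (bag w) f g → φ w f = ψ w g

namespace IsWeightedTree

variable {X : (Fin k → B) → (Fin k → A) → ℝ} {V : Type} {G : SimpleGraph V} {bag : V → Finset Q}
  {φ : V → (Q → A) → ℝ} {ψ : V → (Q → B) → ℝ}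

theorem mem_of_adj (h : IsWeightedTree X G bag φ ψ) {l p : V} (hp : ∀ u, G.Adj l u → u = p) {x : Q}
    (hx : x ∈ bag l) {w : V} (hw : w ≠ l) (hxw : x ∈ bag w) : x ∈ bag p := by
  classical
  obtain ⟨r⟩ := h.isTree.connected l w
  have hr := h.mem_of_path x l w _ r.bypass_isPath hx hxw
  generalize r.bypass = r' at hr
  cases r' with
  | nil => exact (hw rfl).elim
  | cons hadj r' =>
    obtain rfl := hp _ hadj
    exact hr _ (by simp)

/-- The weight of the leaf depends only on values in the bag of `p`, so it can be multiplied into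
the weight of `p`. -/
theorem removeLeaf (h : IsWeightedTree X G bag φ ψ) {l p : V} (hlp : G.Adj l p)
    (hp : ∀ u, G.Adj l u → u = p) (hsub : bag l ⊆ bag p) [Fintype V] [DecidableEq V] :
    IsWeightedTree X (G.induce {l}ᶜ) (fun w => bag w.1)
      (fun w f => φ w.1 f * if w.1 = p then φ l f else 1)
      (fun w g => ψ w.1 g * if w.1 = p then ψ l g else 1) where
  isTree := by
    classical
    refine ⟨h.isTree.connected.induce_compl_singleton_of_degree_eq_one ?_,
      h.isTree.isAcyclic.induce _⟩
    exact SimpleGraph.degree_eq_one_iff_existsUnique_adj.2 ⟨p, hlp, hp⟩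
  mem_of_path x w₁ w₂ r hr h₁ h₂ w hw := by
    refine h.mem_of_path x _ _ (r.map (SimpleGraph.Embedding.induce _).toHom)
      (hr.map Subtype.val_injective) h₁ h₂ w.1 ?_
    rw [SimpleGraph.Walk.support_map]
    exact List.mem_map_of_mem hw
  card_le w := h.card_le w
  congr_left w f f' hf := by
    rw [h.congr_left w f f' hf]
    split_ifs with e
    · rw [h.congr_left l f f' fun x hx => hf x (e ▸ hsub hx)]
    · rfl
  congr_right w g g' hg := by
    rw [h.congr_right w g g' hg]
    split_ifs with e
    · rw [h.congr_right l g g' fun x hx => hg x (e ▸ hsub hx)]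
    · rfl
  related w f g hfg := by
    rw [h.related w f g hfg]
    split_ifs with e
    · rw [h.related l f g (hfg.mono (e ▸ hsub))]
    · rfl

theorem prod_removeLeaf {A : Type*} (φ : V → (Q → A) → ℝ) [Fintype V] [DecidableEq V] {l p : V}
    (hne : p ≠ l) (f : Q → A) :
    ∏ w : ({l}ᶜ : Set V), (φ w.1 f * if w.1 = p then φ l f else 1) = ∏ w, φ w f := by
  rw [Finset.prod_mul_distrib, Fintype.prod_eq_mul_prod_compl l, mul_comm]
  congr 1
  · rw [Finset.prod_eq_single (⟨p, hne⟩ : ({l}ᶜ : Set V))]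
    · simp
    · intro w _ hw
      exact if_neg fun e => hw (Subtype.ext e)
    · simp
  · exact (Finset.prod_subtype ({l}ᶜ : Finset V) (fun w => by simp) fun w => φ w f).symm

variable [DecidableEq Q] [Fintype A] [Fintype B]

theorem eliminate {L : FirstOrder.Language.{u, v}} [L.Structure A] [L.Structure B]
    (hX : IsCoupling L X) (h : IsWeightedTree X G bag φ ψ) [DecidableEq V] {l : V} {x : Q}
    (hx : x ∈ bag l) (huniq : ∀ w, w ≠ l → x ∉ bag w) :
    IsWeightedTree X G (fun w => (bag w).erase x)
      (Function.update φ l fun f => ∑ c, φ l (Function.update f x c))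
      (Function.update ψ l fun g => ∑ d, ψ l (Function.update g x d)) where
  isTree := h.isTree
  mem_of_path y w₁ w₂ p hp h₁ h₂ w hw := by
    rw [Finset.mem_erase] at h₁ h₂ ⊢
    exact ⟨h₁.1, h.mem_of_path y w₁ w₂ p hp h₁.2 h₂.2 w hw⟩
  card_le w := Finset.card_erase_le.trans (h.card_le w)
  congr_left w f f' hf := by
    by_cases hw : w = l
    · subst hw
      simp only [Function.update_self]
      refine Finset.sum_congr rfl fun c _ => h.congr_left _ _ _ fun y hy => ?_
      by_cases e : y = x
      · subst e
        simp
      · simp [e, hf y (Finset.mem_erase.2 ⟨e, hy⟩)]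
    · simp only [Function.update_of_ne hw]
      exact h.congr_left _ _ _ (by simpa [Finset.erase_eq_of_notMem (huniq w hw)] using hf)
  congr_right w f f' hf := by
    by_cases hw : w = l
    · subst hw
      simp only [Function.update_self]
      refine Finset.sum_congr rfl fun c _ => h.congr_right _ _ _ fun y hy => ?_
      by_cases e : y = x
      · subst e
        simp
      · simp [e, hf y (Finset.mem_erase.2 ⟨e, hy⟩)]
    · simp only [Function.update_of_ne hw]
      exact h.congr_right _ _ _ (by simpa [Finset.erase_eq_of_notMem (huniq w hw)] using hf)
  related w f g hfg := by
    by_cases hw : w = l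
    · subst hw
      simp only [Function.update_self]
      exact hX.sum_update_eq (h.card_le w) hx (h.related w) hfg
    · simp only [Function.update_of_ne hw]
      exact h.related w f g (by simpa [Finset.erase_eq_of_notMem (huniq w hw)] using hfg)

/-- The outer sum still runs over all maps on `Q`, in which the value at `x` no longer matters; this
accounts for the factor |A|. -/
theorem sum_eliminate {A : Type*} [Fintype A] {φ : V → (Q → A) → ℝ}
    (hφ : ∀ w f f', (∀ x ∈ bag w, f x = f' x) → φ w f = φ w f') [Fintype V] [DecidableEq V]
    [Fintype Q] {l : V} {x : Q} (huniq : ∀ w, w ≠ l → x ∉ bag w) :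
    ∑ f, ∏ w, Function.update φ l (fun f => ∑ c, φ l (Function.update f x c)) w f =
      Fintype.card A * ∑ f, ∏ w, φ w f := by
  have := sum_sum_update x (φ l) (fun f => ∏ w ∈ {l}ᶜ, φ w f) fun f c =>
    Finset.prod_congr rfl fun w hw => hφ _ _ _ fun y hy => Function.update_of_ne (by
      rintro rfl
      exact huniq w (by simpa using hw) hy) _ _
  convert this using 1
  · refine Finset.sum_congr rfl fun f _ => ?_
    rw [Fintype.prod_eq_mul_prod_compl l, Function.update_self]
    congr 1
    refine Finset.prod_congr rfl fun w hw => ?_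
    rw [Function.update_of_ne (by simpa using hw)]
  · congr 1
    exact Finset.sum_congr rfl fun f _ => Fintype.prod_eq_mul_prod_compl l _

/-- Weights that are compatible with a coupling have the same total sum over `A` and over `B`. -/
theorem sum_prod_eq {L : FirstOrder.Language.{u, v}} [L.Structure A] [L.Structure B] [Fintype Q]
    (hX : IsCoupling L X) (hk : 1 ≤ k) (n : ℕ) : ∀ {V : Type} [Fintype V] {G : SimpleGraph V}
      {bag : V → Finset Q} {φ : V → (Q → A) → ℝ} {ψ : V → (Q → B) → ℝ},
      IsWeightedTree X G bag φ ψ → ∑ w, (bag w).card + Fintype.card V = n →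
      ∑ f, ∏ w, φ w f = ∑ g, ∏ w, ψ w g := by
  induction n using Nat.strong_induction_on with
  | _ n ih =>
  intro V _ G bag φ ψ h hn
  classical
  have hAB := hX.card_eq hk
  -- An element in only one bag is summed out. If there is none, every leaf bag is contained in its
  -- neighbour's bag and the leaf is absorbed.
  by_cases hel : ∃ l, ∃ x ∈ bag l, ∀ w, w ≠ l → x ∉ bag w
  · obtain ⟨l, x, hx, huniq⟩ := hel
    -- The factor |A| = |B| can be cancelled only if nonzero; otherwise both sums are empty, as `Q`
    -- contains `x`.
    by_cases hA : Fintype.card A = 0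
    · have hB := hAB.symm.trans hA
      rw [Fintype.card_eq_zero_iff] at hA hB
      have : IsEmpty (Q → A) := ⟨fun f => isEmptyElim (f x)⟩
      have : IsEmpty (Q → B) := ⟨fun f => isEmptyElim (f x)⟩
      simp
    · have key := ih _ ?_ (h.eliminate hX hx huniq) rfl
      · rw [sum_eliminate h.congr_left huniq, sum_eliminate h.congr_right huniq, ← hAB] at key
        exact mul_left_cancel₀ (Nat.cast_ne_zero.2 hA) key
      · rw [← hn]
        refine Nat.add_lt_add_right (Finset.sum_lt_sum (fun w _ => Finset.card_erase_le)
          ⟨l, Finset.mem_univ _, Finset.card_erase_lt_of_mem hx⟩) _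
  · push Not at hel
    rcases subsingleton_or_nontrivial V with hV | hV
    · obtain ⟨v⟩ := h.isTree.connected.nonempty
      have hbag : bag v = ∅ := by
        refine Finset.eq_empty_of_forall_notMem fun x hx => ?_
        obtain ⟨w, hw, -⟩ := hel v x hx
        exact hw (Subsingleton.elim _ _)
      -- For an empty bag and k ≥ 1 no enumeration exists, so all pairs are vacuously related and
      -- both weights equal one constant.
      have hconst : ∀ f g, φ v f = ψ v g := fun f g => h.related v f g fun e he => by
        have := he ⟨0, hk⟩
        simp [hbag] at this
      have hcard : Fintype.card (Q → A) = Fintype.card (Q → B) := by simp [hAB]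
      simp only [Fintype.prod_subsingleton _ v]
      exact Fintype.sum_equiv (Fintype.equivOfCardEq hcard) _ _ fun f => hconst _ _
    · obtain ⟨l, hl⟩ := h.isTree.exists_vert_degree_one_of_nontrivial
      obtain ⟨p, hlp, hp⟩ := SimpleGraph.degree_eq_one_iff_existsUnique_adj.1 hl
      have hsub : bag l ⊆ bag p := fun x hx => by
        obtain ⟨w, hw, hxw⟩ := hel l x hx
        exact h.mem_of_adj hp hx hw hxw
      have key := ih _ ?_ (h.removeLeaf hlp hp hsub) rfl
      · simpa only [prod_removeLeaf _ hlp.ne'] using key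
      · rw [← hn]
        have h₁ : Fintype.card ({l}ᶜ : Set V) < Fintype.card V :=
          Fintype.card_lt_of_injective_of_notMem Subtype.val Subtype.val_injective (b := l) (by simp)
        have h₂ : ∑ w : ({l}ᶜ : Set V), (bag w.1).card ≤ ∑ w, (bag w).card := by
          rw [Fintype.sum_eq_add_sum_compl l, 
            ← Finset.sum_subtype ({l}ᶜ : Finset V) (fun w => by simp) fun w => (bag w).card]
          exact Nat.le_add_left _ _
        omega

end IsWeightedTree

variable {L : FirstOrder.Language.{u, v}} [L.Structure A] [L.Structure B] [Fintype A] [Fintype B]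
  {X : (Fin k → B) → (Fin k → A) → ℝ} [L.Structure Q]

open Classical in
/-- The indicator function of the maps that preserve the constraints inside a bag. -/
noncomputable def bagWeight (L : FirstOrder.Language.{u, v}) [L.Structure Q] {A : Type*}
    [L.Structure A] (s : Finset Q) (f : Q → A) : ℝ :=
  if ∀ c : Constraint L Q, (∀ i, c.tup i ∈ s) → Structure.RelMap c.sym.2 (f ∘ c.tup) then 1 else 0

open Classical in
theorem prod_bagWeight (D : TreeDecomposition L Q) {A : Type*} [L.Structure A] (f : Q → A) :
    ∏ w, bagWeight L (D.bag w) f = if IsHom L f then 1 else 0 := by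
  simp only [bagWeight]
  split_ifs with h
  · exact Finset.prod_eq_one fun w _ => if_pos fun c _ => h _ _ c.holds
  · simp only [IsHom, not_forall] at h
    obtain ⟨R, x, hx, hf⟩ := h
    obtain ⟨w, hw⟩ := D.constraint_subset ⟨R, x, hx⟩
    exact Finset.prod_eq_zero (Finset.mem_univ w) (if_neg fun h => hf (h ⟨R, x, hx⟩ hw))

theorem homCount_eq_sum [L.IsRelational] [Fintype Q] [DecidableEq Q] (D : TreeDecomposition L Q)
    (A : Type*) [L.Structure A] [Fintype A] :
    (homCount L Q A : ℝ) = ∑ f : Q → A, ∏ w, bagWeight L (D.bag w) f := by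
  classical
  simp only [prod_bagWeight]
  rw [homCount, Nat.card_congr (homEquiv L Q A), Nat.card_eq_fintype_card, Fintype.card_subtype,
    Finset.card_filter]
  push_cast
  rfl

theorem bagWeight_congr {A : Type*} [L.Structure A] {s : Finset Q} {f f' : Q → A}
    (h : ∀ x ∈ s, f x = f' x) : bagWeight L s f = bagWeight L s f' := by
  classical
  refine if_congr (forall_congr' fun c => imp_congr_right fun hc => ?_) rfl rfl
  rw [show f ∘ c.tup = f' ∘ c.tup from funext fun i => h _ (hc i)]

/-- A constraint inside the bag, padded to length k, is an admissible enumeration, and couplings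
preserve relations on their support. -/
theorem IsCoupling.bagWeight_eq (hX : IsCoupling L X) (hpos : ∀ R : Sym L, 1 ≤ R.1)
    (hle : ∀ R : Sym L, R.1 ≤ k) {s : Finset Q} {f : Q → A} {g : Q → B} (h : Related X s f g) :
    bagWeight L s f = bagWeight L s g := by
  classical
  refine if_congr (forall_congr' fun c => imp_congr_right fun hc => ?_) rfl rfl
  have := hX.rel_iff _ _ (h (c.tup ∘ padIdx k (hpos c.sym)) fun t => hc _) c.sym
    (Fin.castLE (hle c.sym))
  have e : c.tup ∘ padIdx k (hpos c.sym) ∘ Fin.castLE (hle c.sym) = c.tup :=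
    funext fun s => by simp [padIdx_castLE]
  rw [Function.comp_assoc, Function.comp_assoc, Function.comp_assoc, Function.comp_assoc, e] at this
  exact this.symm

theorem IsCoupling.homCount_eq [L.IsRelational] [Finite Q] (hX : IsCoupling L X) (hk : 1 ≤ k)
    (hpos : ∀ R : Sym L, 1 ≤ R.1) (hle : ∀ R : Sym L, R.1 ≤ k)
    (hQ : treewidth L Q < (k : ℤ)) : homCount L Q A = homCount L Q B := by
  classical
  have := Fintype.ofFinite Q
  obtain ⟨D, hD⟩ := (treewidth_lt_iff L Q k).1 hQ
  have h : IsWeightedTree X D.G D.bag (fun w => bagWeight L (D.bag w))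
      (fun w => bagWeight L (D.bag w)) :=
    ⟨D.isTree, D.mem_of_path, hD, fun _ _ _ => bagWeight_congr, fun _ _ _ => bagWeight_congr,
      fun _ _ _ => hX.bagWeight_eq hpos hle⟩
  have := h.sum_prod_eq hX hk _ rfl
  rw [← homCount_eq_sum, ← homCount_eq_sum] at this
  exact_mod_cast this

end RelWL

theorem mainTheorem4 (L : FirstOrder.Language.{u, v}) [L.IsRelational] [Finite (RelWL.Sym L)]
    (k : ℕ) (hk : 1 ≤ k)
    (hpos : ∀ R : RelWL.Sym L, 1 ≤ R.1) (hle : ∀ R : RelWL.Sym L, R.1 ≤ k)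
    (A : Type a) (B : Type b) [L.Structure A] [L.Structure B] [Fintype A] [Fintype B] :
    RelWL.EqWL L k A B ↔
      ∀ (Q : Type q) [L.Structure Q] [Finite Q],
        RelWL.treewidth L Q < (k : ℤ) → RelWL.homCount L Q A = RelWL.homCount L Q B := by
  constructor
  · intro h Q _ _ hQ
    obtain ⟨X, hX⟩ := h.exists_isCoupling hk hpos hle
    exact hX.homCount_eq hk hpos hle hQ
  · intro H
    exact (RelWL.Term.isCoupling (RelWL.Decomposed.sum_eval_eq H)).eqWL hpos hle
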